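/- Let $W$ be a finite group acting by homeomorphisms on a locally compact Hausdorff space $X$, and put $(\alpha_w b)(x)=b(w^{-1}x)$ for functions $b$ on $X$. Let $\gamma:W\times W\to C(X,\mathbb T)$ satisfy $$\alpha_u(\gamma(v,w))\,\gamma(u,vw)=\gamma(u,v)\,\gamma(uv,w),\qquad \gamma(1,w)=\gamma(w,1)=1 ,$$ and write $\gamma_x(v,w)=\gamma(v,w)(x)$. Let $C_0(X)\rtimes_\gamma W=\{\sum_{w\in W} b_w w : b_w\in C_0(X)\}$ be the twisted crossed product $C^*$-algebra, with product $b_1w_1\cdot b_2w_2=b_1\alpha_{w_1}(b_2)\gamma(w_1,w_2)\,w_1w_2$, involution $(bw)^*=\gamma(w^{-1},w)^*\alpha_{w^{-1}}(b^*)\,w^{-1}$, and the operator norm in the regular representation. Let $E$ be a right Hilbert $C_0(X)$-module with a twisted action of $W$, i.e. invertible bounded operators $U_w$ on $E$ ($w\in W$) with $$U_w(\xi b)=U_w(\xi)\alpha_w(b),\qquad \langle U_w\xi\,|\,U_w\eta\rangle=\alpha_w\langle\xi\,|\,\eta\rangle,\qquad U_vU_w\xi=U_{vw}(\xi)\,\gamma(v,w)^*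 .$$ Let $\mathrm K_{C_0(X)}(E)$ be the $C^*$-algebra of compact operators on $E$ (the norm closure of the span of the operators $\zeta\mapsto\xi\langle\eta\,|\,\zeta\rangle$), and let $\mathrm K_{C_0(X)}(E)^W$ be the subalgebra of those that commute with all $U_w$; it acts on $E$ on the left in the obvious way. Let $C_0(X)\rtimes_\gamma W$ act on $E$ on the right by $\xi\cdot bw=U_w^{-1}(\xi b)$, and equip $E$ with the $C_0(X)\rtimes_\gamma W$-valued inner product $\langle\!\langle\xi\,|\,\eta\rangle\!\rangle=\sum_{w\in W}\langle\xi\,|\,U_w\eta\rangle\,w$. For $x\in X$ let $E_x=E\otimes_{C_0(X)}\mathbb C_x$ be the fibre of $E$ at $x$ (the Hilbert space obtained from $E$ and the semi-inner product $\langle\xi\,|\,\eta\rangle(x)$), let $\xi(x)\in E_x$ be the image of $\xi\in E$, and let $W_x$ be the stabiliser of $x$. The unitary operators $I_{w,x}:E_x\to E_{wx}$, $I_{w,x}(\xi(x))=(U_w\xi)(wx)$, define a unitary $\overline{\gamma_x}$-representation $I_x:w\mapsto I_{w,x}$ of $W_x$ on $E_x$. Here a unitary $\eta$-representation of a group $G$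 is a map $\pi$ from $G$ to the unitary operators on a Hilbert space with $\pi(g_1)\pi(g_2)=\eta(g_1,g_2)\pi(g_1g_2)$; its contragredient is the $\overline\eta$-representation $\overline\pi(g)\overline h=\overline{\pi(g)h}$ on the complex conjugate Hilbert space. Then $E$, with these actions and this inner product, is a Morita equivalence (that is, an imprimitivity bimodule) between $\mathrm K_{C_0(X)}(E)^W$ and $C_0(X)\rtimes_\gamma W$ if and only if, for every $x\in X$, every irreducible unitary $\gamma_x$-representation of $W_x$ occurs in (is isomorphic to a subrepresentation of) the contragredient of $I_x$. -/

import Mathlib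

open scoped ZeroAtInfty
open Filter Topology

noncomputable section

set_option linter.unusedSectionVars false

/-! ### Functions on a locally compact space with an action of a finite group -/

instance C0.instPartialOrder (X : Type*) [TopologicalSpace X] :
    PartialOrder C₀(X, ℂ) :=
  CStarAlgebra.spectralOrder _

instance C0.instStarOrderedRing (X : Type*) [TopologicalSpace X] :
    StarOrderedRing C₀(X, ℂ) :=
  CStarAlgebra.spectralOrderedRing _

/-- The action `(α_w b)(x) = b (w⁻¹ x)` of `W` on `C₀(X)`. -/
def C0.translate {W X : Type*} [Group W] [TopologicalSpace X] [MulAction W X]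
    [ContinuousConstSMul W X] (w : W) (b : C₀(X, ℂ)) : C₀(X, ℂ) :=
  b.comp (Homeomorph.smul w⁻¹ : X ≃ₜ X).toCocompactMap

@[simp]
theorem C0.translate_apply {W X : Type*} [Group W] [TopologicalSpace X] [MulAction W X]
    [ContinuousConstSMul W X] (w : W) (b : C₀(X, ℂ)) (x : X) :
    C0.translate w b x = b (w⁻¹ • x) := rfl

/-- The product `u b ∈ C₀(X)` of a unitary multiplier `u : X → 𝕋` and `b ∈ C₀(X)`. -/
def C0.unitaryMul {X : Type*} [TopologicalSpace X] (u : C(X, Circle)) (b : C₀(X, ℂ)) :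
    C₀(X, ℂ) where
  toFun x := (u x : ℂ) * b x
  continuous_toFun := by fun_prop
  zero_at_infty' := by
    have h := b.zero_at_infty'
    rw [tendsto_zero_iff_norm_tendsto_zero] at h ⊢
    refine h.congr fun x => ?_
    rw [norm_mul, Circle.norm_coe, one_mul]
    rfl

@[simp]
theorem C0.unitaryMul_apply {X : Type*} [TopologicalSpace X] (u : C(X, Circle))
    (b : C₀(X, ℂ)) (x : X) : C0.unitaryMul u b x = (u x : ℂ) * b x := rfl

/-- A map `γ : W × W → C(X, 𝕋)` which together with the translation action `α` is a twisted action
of `W` on `C₀(X)`.  (As `C₀(X)` is commutative, `α_v α_w b = γ(v,w) α_{vw}(b) γ(v,w)^*` holds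
automatically.) -/
structure TwistingCocycle (W X : Type*) [Group W] [TopologicalSpace X] [MulAction W X] where
  toFun : W → W → C(X, Circle)
  cocycle : ∀ (u v w : W) (x : X),
    toFun v w (u⁻¹ • x) * toFun u (v * w) x = toFun u v x * toFun (u * v) w x
  one_left : ∀ (w : W) (x : X), toFun 1 w x = 1
  one_right : ∀ (w : W) (x : X), toFun w 1 x = 1

instance TwistingCocycle.instCoeFun {W X : Type*} [Group W] [TopologicalSpace X] [MulAction W X] :
    CoeFun (TwistingCocycle W X) (fun _ => W → W → C(X, Circle)) := ⟨TwistingCocycle.toFun⟩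

/-! ### The twisted crossed product `C₀(X) ⋊_γ W` -/

/-- The twisted crossed product: its elements are the formal sums `∑ w, b_w w`,
represented by the families `w ↦ b_w`. -/
@[nolint unusedArguments]
def TwistedCrossedProduct {W X : Type*} [Group W] [TopologicalSpace X] [MulAction W X]
    (_γ : TwistingCocycle W X) : Type _ :=
  W → C₀(X, ℂ)

namespace TwistedCrossedProduct

section Algebra

variable {W X : Type*} [Group W] [TopologicalSpace X] [MulAction W X] {γ : TwistingCocycle W X}

/-- The element `∑ w, b w • w`. -/
def mk (b : W → C₀(X, ℂ)) : TwistedCrossedProduct γ := b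

/-- The coefficient `b_w` of `∑ w, b_w w`. -/
def coeff (f : TwistedCrossedProduct γ) (w : W) : C₀(X, ℂ) := f w

@[simp]
theorem coeff_mk (b : W → C₀(X, ℂ)) (w : W) : (mk b : TwistedCrossedProduct γ).coeff w = b w := rfl

@[ext]
theorem ext {f g : TwistedCrossedProduct γ} (h : ∀ w, f.coeff w = g.coeff w) : f = g := funext h

instance instAddCommGroup : AddCommGroup (TwistedCrossedProduct γ) :=
  inferInstanceAs (AddCommGroup (W → C₀(X, ℂ)))

instance instModule : Module ℂ (TwistedCrossedProduct γ) :=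
  inferInstanceAs (Module ℂ (W → C₀(X, ℂ)))

@[simp] theorem coeff_zero (w : W) : (0 : TwistedCrossedProduct γ).coeff w = 0 := rfl
@[simp] theorem coeff_add (f g : TwistedCrossedProduct γ) (w : W) :
    (f + g).coeff w = f.coeff w + g.coeff w := rfl
@[simp] theorem coeff_smul (c : ℂ) (f : TwistedCrossedProduct γ) (w : W) :
    (c • f).coeff w = c • f.coeff w := rfl

variable [Fintype W] [ContinuousConstSMul W X]

/-- The product determined by `b₁ w₁ · b₂ w₂ = b₁ α_{w₁}(b₂) γ(w₁, w₂) w₁ w₂`. -/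
instance instMul : Mul (TwistedCrossedProduct γ) where
  mul f g := mk fun u => ∑ w : W,
    C0.unitaryMul (γ w (w⁻¹ * u)) (f.coeff w * C0.translate w (g.coeff (w⁻¹ * u)))

/-- The involution determined by `(b w)^* = γ(w⁻¹, w)^* α_{w⁻¹}(b^*) w⁻¹`. -/
instance instStar : Star (TwistedCrossedProduct γ) where
  star f := mk fun u => C0.unitaryMul (γ u u⁻¹)⁻¹ (C0.translate u (star (f.coeff u⁻¹)))

theorem coeff_mul (f g : TwistedCrossedProduct γ) (u : W) : (f * g).coeff u = ∑ w : W,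
    C0.unitaryMul (γ w (w⁻¹ * u)) (f.coeff w * C0.translate w (g.coeff (w⁻¹ * u))) := rfl

theorem coeff_star (f : TwistedCrossedProduct γ) (u : W) : (star f).coeff u =
    C0.unitaryMul (γ u u⁻¹)⁻¹ (C0.translate u (star (f.coeff u⁻¹))) := rfl

/-- The regular representation `b w (δ_v ⊗ h) = δ_{wv} ⊗ α_{wv}⁻¹(b γ(w, v)) h`, written as a map
into the C⋆-algebra of `W × W`-matrices over `C₀(X)`. -/
def regular (f : TwistedCrossedProduct γ) : CStarMatrix W W C₀(X, ℂ) :=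
  CStarMatrix.ofMatrix fun u v =>
    C0.translate u⁻¹ (C0.unitaryMul (γ (u * v⁻¹) v) (f.coeff (u * v⁻¹)))

theorem regular_apply (f : TwistedCrossedProduct γ) (u v : W) (x : X) :
    regular f u v x = (γ (u * v⁻¹) v (u • x) : ℂ) * f.coeff (u * v⁻¹) (u • x) := by
  change C0.translate u⁻¹ (C0.unitaryMul (γ (u * v⁻¹) v) (f.coeff (u * v⁻¹))) x = _
  simp

theorem C0_sum_apply {ι : Type*} (s : Finset ι) (F : ι → C₀(X, ℂ)) (x : X) :
    (∑ i ∈ s, F i) x = ∑ i ∈ s, F i x := by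
  classical
  induction s using Finset.induction_on with
  | empty => rfl
  | insert a s ha ih => rw [Finset.sum_insert ha, Finset.sum_insert ha, ← ih]; rfl

theorem regular_add (f g : TwistedCrossedProduct γ) : regular (f + g) = regular f + regular g := by
  refine CStarMatrix.ext fun u v => ?_
  ext x
  change regular (f + g) u v x = regular f u v x + regular g u v x
  simp [regular_apply, mul_add]

theorem regular_smul (c : ℂ) (f : TwistedCrossedProduct γ) :
    regular (c • f) = c • regular f := by
  refine CStarMatrix.ext fun u v => ?_
  ext x
  change regular (c • f) u v x = c * regular f u v x
  simp only [regular_apply, coeff_smul, ZeroAtInftyContinuousMap.smul_apply, smul_eq_mul]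
  ring

theorem regular_zero : regular (0 : TwistedCrossedProduct γ) = 0 := by
  refine CStarMatrix.ext fun u v => ?_
  ext x
  rw [regular_apply]
  simp

theorem regular_mul (f g : TwistedCrossedProduct γ) : regular (f * g) = regular f * regular g := by
  refine CStarMatrix.ext fun u t => ?_
  ext x
  rw [CStarMatrix.mul_apply, C0_sum_apply, regular_apply, coeff_mul, C0_sum_apply,
    Finset.mul_sum]
  refine Fintype.sum_equiv ((Equiv.inv W).trans (Equiv.mulRight u)) _ _ fun w => ?_
  have h := γ.cocycle w (w⁻¹ * (u * t⁻¹)) t (u • x)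
  have e1 : w⁻¹ * (u * t⁻¹) * t = w⁻¹ * u := by group
  have e2 : w * (w⁻¹ * (u * t⁻¹)) = u * t⁻¹ := by group
  have e3 : u * (w⁻¹ * u)⁻¹ = w := by group
  have e4 : w⁻¹ * u * t⁻¹ = w⁻¹ * (u * t⁻¹) := by group
  rw [e1, e2] at h
  have h' := congrArg (fun z : Circle => (z : ℂ)) h
  simp only [Circle.coe_mul] at h'
  simp only [Equiv.trans_apply, Equiv.inv_apply, Equiv.coe_mulRight,
    ZeroAtInftyContinuousMap.coe_mul, Pi.mul_apply, regular_apply, C0.unitaryMul_apply,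
    C0.translate_apply, e3, e4, mul_smul]
  rw [← mul_smul w⁻¹ u x] at *
  rw [mul_smul] at *
  linear_combination (-(f.coeff w (u • x)) * (g.coeff (w⁻¹ * (u * t⁻¹)) (w⁻¹ • u • x))) * h'

theorem regular_star (f : TwistedCrossedProduct γ) : regular (star f) = star (regular f) := by
  refine CStarMatrix.ext fun u v => ?_
  ext x
  rw [CStarMatrix.star_apply]
  have h := γ.cocycle (u * v⁻¹) (v * u⁻¹) u (u • x)
  have e1 : v * u⁻¹ * u = v := by group
  have e2 : u * v⁻¹ * (v * u⁻¹) = 1 := by group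
  have e3 : (u * v⁻¹)⁻¹ = v * u⁻¹ := by group
  have e4 : (v * u⁻¹) • u • x = v • x := by rw [smul_smul, e1]
  rw [e1, e2, γ.one_left, e3, e4, mul_one] at h
  have h1 : (γ (u * v⁻¹) v (u • x)) * (γ (u * v⁻¹) (v * u⁻¹) (u • x))⁻¹
      = (γ (v * u⁻¹) u (v • x))⁻¹ := by
    rw [← h]; simp
  have h' := congrArg (fun z : Circle => (z : ℂ)) h1
  simp only [Circle.coe_mul, Circle.coe_inv_eq_conj] at h'
  rw [ZeroAtInftyContinuousMap.star_apply, regular_apply, regular_apply, coeff_star]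
  simp only [C0.unitaryMul_apply, C0.translate_apply, ZeroAtInftyContinuousMap.star_apply,
    ContinuousMap.inv_apply, Circle.coe_inv_eq_conj, e3, e4, star_mul']
  rw [← mul_assoc, h']
  rfl

theorem regular_injective :
    Function.Injective (regular : TwistedCrossedProduct γ → CStarMatrix W W C₀(X, ℂ)) := by
  intro f g h
  ext w x
  have h1 : regular f w 1 (w⁻¹ • x) = regular g w 1 (w⁻¹ • x) := by rw [h]
  simpa [regular_apply, γ.one_right] using h1

instance instNonUnitalRing : NonUnitalRing (TwistedCrossedProduct γ) where
  left_distrib a b c := regular_injective (by simp only [regular_mul, regular_add, mul_add])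
  right_distrib a b c := regular_injective (by simp only [regular_mul, regular_add, add_mul])
  zero_mul a := regular_injective (by
    simp only [regular_mul, regular_zero, zero_mul])
  mul_zero a := regular_injective (by
    simp only [regular_mul, regular_zero, mul_zero])
  mul_assoc a b c := regular_injective (by simp only [regular_mul, mul_assoc])

instance instStarRing : StarRing (TwistedCrossedProduct γ) where
  star_involutive a := regular_injective (by simp only [regular_star, star_star])
  star_mul a b := regular_injective (by
    rw [regular_star, regular_mul, regular_mul, regular_star, regular_star]
    exact Matrix.conjTranspose_mul _ _)
  star_add a b := regular_injective (by simp only [regular_star, regular_add, star_add])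

instance instIsScalarTower :
    IsScalarTower ℂ (TwistedCrossedProduct γ) (TwistedCrossedProduct γ) where
  smul_assoc c a b := regular_injective (by
    simp only [smul_eq_mul, regular_smul, regular_mul, smul_mul_assoc])

instance instSMulCommClass :
    SMulCommClass ℂ (TwistedCrossedProduct γ) (TwistedCrossedProduct γ) where
  smul_comm c a b := regular_injective (by
    simp only [smul_eq_mul, regular_smul, regular_mul, mul_smul_comm])

instance instStarModule : StarModule ℂ (TwistedCrossedProduct γ) where
  star_smul c a := regular_injective (by simp only [regular_smul, regular_star, star_smul])

/-- The regular representation as a homomorphism of `*`-algebras. -/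
def regularHom : TwistedCrossedProduct γ →⋆ₙₐ[ℂ] CStarMatrix W W C₀(X, ℂ) where
  toFun := regular
  map_smul' := regular_smul
  map_zero' := regular_zero
  map_add' := regular_add
  map_mul' := regular_mul
  map_star' := regular_star

/-- The norm of `C₀(X) ⋊_γ W` is the operator norm in the regular representation. -/
instance instNonUnitalNormedRing : NonUnitalNormedRing (TwistedCrossedProduct γ) :=
  NonUnitalNormedRing.induced (TwistedCrossedProduct γ) (CStarMatrix W W C₀(X, ℂ)) regularHom
    regular_injective

theorem norm_def (f : TwistedCrossedProduct γ) : ‖f‖ = ‖regular f‖ := rfl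

instance instNormedSpace : NormedSpace ℂ (TwistedCrossedProduct γ) where
  norm_smul_le c f := by rw [norm_def, norm_def, regular_smul, norm_smul]

theorem matrix_norm_mul_self_le {n A : Type*} [Fintype n] [NonUnitalCStarAlgebra A]
    [PartialOrder A] [StarOrderedRing A] (M : CStarMatrix n n A) :
    ‖M‖ * ‖M‖ ≤ ‖star M * M‖ :=
  CStarRing.norm_mul_self_le M

theorem norm_mul_self_le (f : TwistedCrossedProduct γ) : ‖f‖ * ‖f‖ ≤ ‖star f * f‖ := by
  have h : ‖regular f‖ * ‖regular f‖ ≤ ‖star (regular f) * regular f‖ :=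
    matrix_norm_mul_self_le (regular f)
  rw [← regular_star, ← regular_mul] at h
  exact h

instance instCStarRing : CStarRing (TwistedCrossedProduct γ) where
  norm_mul_self_le := norm_mul_self_le

theorem isometry_regular :
    Isometry (regular : TwistedCrossedProduct γ → CStarMatrix W W C₀(X, ℂ)) :=
  AddMonoidHomClass.isometry_of_norm (regularHom (γ := γ)) fun _ => rfl

instance instCompleteSpace : CompleteSpace (TwistedCrossedProduct γ) := by
  have hcl : IsClosed (Set.range (regular (γ := γ))) := by
    have : Set.range (regular (γ := γ)) =
        {M | ∀ (u v : W) (x : X), M u v x =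
          (γ (u * v⁻¹) v (u • x) : ℂ) * M (u * v⁻¹) 1 (v • x)} := by
      ext M
      constructor
      · rintro ⟨f, rfl⟩ u v x
        simp [regular_apply, γ.one_right, smul_smul]
      · intro hM
        refine ⟨mk fun w => C0.translate w (M w 1), CStarMatrix.ext fun u v => ?_⟩
        ext x
        rw [regular_apply, hM u v x]
        simp [smul_smul]
    rw [this]
    simp only [Set.ofPred_forall]
    have key : ∀ (u v : W) (x : X),
        Continuous fun M : CStarMatrix W W C₀(X, ℂ) => M u v x := by
      intro u v x
      have h1 : Continuous fun M : CStarMatrix W W C₀(X, ℂ) => M u v :=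
        (continuous_apply v).comp (continuous_apply u)
      have h2 : Continuous fun b : C₀(X, ℂ) => b x := by
        refine (LipschitzWith.of_dist_le_mul (K := 1) fun a b => ?_).continuous
        rw [NNReal.coe_one, one_mul, ← ZeroAtInftyContinuousMap.dist_toBCF_eq_dist]
        exact BoundedContinuousFunction.dist_coe_le_dist (f := a.toBCF) (g := b.toBCF) x
      exact h2.comp h1
    refine isClosed_iInter fun u => isClosed_iInter fun v => isClosed_iInter fun x => ?_
    exact isClosed_eq (key u v x) (continuous_const.mul (key _ _ _))
  exact (completeSpace_iff_isComplete_range isometry_regular.isUniformInducing).2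
    hcl.isComplete

instance instNonUnitalCStarAlgebra :
    NonUnitalCStarAlgebra (TwistedCrossedProduct γ) where

end Algebra

end TwistedCrossedProduct

/-! ### Adjointable and compact operators on a Hilbert module -/

/-- The adjointable operators on a Hilbert module `E` over a commutative C⋆-algebra `A`:
an operator together with its adjoint. -/
structure AdjointableOp (A E : Type*) [NonUnitalCommCStarAlgebra A] [PartialOrder A]
    [StarOrderedRing A] [NormedAddCommGroup E] [NormedSpace ℂ E] [SMul A E]
    [CStarModule A E] where
  toCLM : E →L[ℂ] E
  adj : E →L[ℂ] E
  inner_toCLM : ∀ ξ η : E, inner A (toCLM ξ) η = inner A ξ (adj η)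

namespace AdjointableOp

variable {A E : Type*} [NonUnitalCommCStarAlgebra A] [PartialOrder A] [StarOrderedRing A]
  [NormedAddCommGroup E] [NormedSpace ℂ E] [SMul A E] [CStarModule A E]

theorem eq_of_inner_left {ξ η : E} (h : ∀ ζ : E, inner A ζ ξ = inner A ζ η) : ξ = η := by
  have h1 : inner A (ξ - η) (ξ - η) = (0 : A) := by
    rw [CStarModule.inner_sub_right, h, sub_self]
  exact sub_eq_zero.1 (CStarModule.inner_self.1 h1)

theorem inner_adj (T : AdjointableOp A E) (ξ η : E) :
    inner A (T.adj ξ) η = inner A ξ (T.toCLM η) := by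
  rw [← CStarModule.star_inner, ← T.inner_toCLM, CStarModule.star_inner]

theorem toCLM_injective : Function.Injective (toCLM : AdjointableOp A E → E →L[ℂ] E) := by
  rintro ⟨S, S', hS⟩ ⟨T, T', hT⟩ (rfl : S = T)
  congr
  ext ξ
  exact eq_of_inner_left (A := A) fun ζ => by rw [← hS, ← hT]

instance : Zero (AdjointableOp A E) := ⟨⟨0, 0, fun ξ η => by simp⟩⟩
instance : Add (AdjointableOp A E) :=
  ⟨fun S T => ⟨S.toCLM + T.toCLM, S.adj + T.adj, fun ξ η => by
    simp [S.inner_toCLM, T.inner_toCLM]⟩⟩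
instance : Neg (AdjointableOp A E) :=
  ⟨fun S => ⟨-S.toCLM, -S.adj, fun ξ η => by simp [S.inner_toCLM]⟩⟩
instance : Sub (AdjointableOp A E) :=
  ⟨fun S T => ⟨S.toCLM - T.toCLM, S.adj - T.adj, fun ξ η => by
    simp [S.inner_toCLM, T.inner_toCLM]⟩⟩
instance : Mul (AdjointableOp A E) :=
  ⟨fun S T => ⟨S.toCLM * T.toCLM, T.adj * S.adj, fun ξ η => by
    simp [S.inner_toCLM, T.inner_toCLM]⟩⟩
instance : SMul ℂ (AdjointableOp A E) :=
  ⟨fun c S => ⟨c • S.toCLM, star c • S.adj, fun ξ η => by simp [S.inner_toCLM]⟩⟩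
instance : SMul ℕ (AdjointableOp A E) :=
  ⟨fun n S => ⟨n • S.toCLM, n • S.adj, fun ξ η => by
    rw [← Nat.cast_smul_eq_nsmul ℂ, ← Nat.cast_smul_eq_nsmul ℂ n S.adj]
    simp [S.inner_toCLM]⟩⟩
instance : SMul ℤ (AdjointableOp A E) :=
  ⟨fun n S => ⟨n • S.toCLM, n • S.adj, fun ξ η => by
    rw [← Int.cast_smul_eq_zsmul ℂ, ← Int.cast_smul_eq_zsmul ℂ n S.adj]
    simp [S.inner_toCLM]⟩⟩
instance : Star (AdjointableOp A E) := ⟨fun S => ⟨S.adj, S.toCLM, S.inner_adj⟩⟩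

@[simp] theorem zero_toCLM : (0 : AdjointableOp A E).toCLM = 0 := rfl
@[simp] theorem add_toCLM (S T : AdjointableOp A E) : (S + T).toCLM = S.toCLM + T.toCLM := rfl
@[simp] theorem mul_toCLM (S T : AdjointableOp A E) : (S * T).toCLM = S.toCLM * T.toCLM := rfl
@[simp] theorem smul_toCLM (c : ℂ) (S : AdjointableOp A E) : (c • S).toCLM = c • S.toCLM := rfl
@[simp] theorem star_toCLM (S : AdjointableOp A E) : (star S).toCLM = S.adj := rfl
@[simp] theorem star_adj (S : AdjointableOp A E) : (star S).adj = S.toCLM := rfl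
@[simp] theorem add_adj (S T : AdjointableOp A E) : (S + T).adj = S.adj + T.adj := rfl
@[simp] theorem mul_adj (S T : AdjointableOp A E) : (S * T).adj = T.adj * S.adj := rfl
@[simp] theorem smul_adj (c : ℂ) (S : AdjointableOp A E) : (c • S).adj = star c • S.adj := rfl

instance instNonUnitalRing : NonUnitalRing (AdjointableOp A E) :=
  toCLM_injective.nonUnitalRing toCLM rfl (fun _ _ => rfl) (fun _ _ => rfl) (fun _ => rfl)
    (fun _ _ => rfl) (fun _ _ => rfl) (fun _ _ => rfl)

instance instStarRing : StarRing (AdjointableOp A E) where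
  star_involutive _ := rfl
  star_mul _ _ := rfl
  star_add _ _ := rfl

/-- The operator underlying an adjointable operator, as a ring homomorphism. -/
def toCLMHom : AdjointableOp A E →ₙ+* (E →L[ℂ] E) where
  toFun := toCLM
  map_zero' := rfl
  map_add' _ _ := rfl
  map_mul' _ _ := rfl

instance instModule : Module ℂ (AdjointableOp A E) :=
  toCLM_injective.module ℂ (toCLMHom : AdjointableOp A E →ₙ+* (E →L[ℂ] E)).toAddMonoidHom
    fun _ _ => rfl

/-- The norm of an adjointable operator is its operator norm. -/
instance instNonUnitalNormedRing : NonUnitalNormedRing (AdjointableOp A E) :=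
  NonUnitalNormedRing.induced (AdjointableOp A E) (E →L[ℂ] E) toCLMHom toCLM_injective

theorem norm_def (S : AdjointableOp A E) : ‖S‖ = ‖S.toCLM‖ := rfl

instance instNormedSpace : NormedSpace ℂ (AdjointableOp A E) where
  norm_smul_le c S := by rw [norm_def, norm_def, smul_toCLM, norm_smul]

instance instIsScalarTower : IsScalarTower ℂ (AdjointableOp A E) (AdjointableOp A E) where
  smul_assoc c S T := toCLM_injective (smul_mul_assoc c S.toCLM T.toCLM)

instance instSMulCommClass : SMulCommClass ℂ (AdjointableOp A E) (AdjointableOp A E) where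
  smul_comm c S T := toCLM_injective (mul_smul_comm c S.toCLM T.toCLM).symm

instance instStarModule : StarModule ℂ (AdjointableOp A E) where
  star_smul _ _ := toCLM_injective rfl

instance instCStarRing : CStarRing (AdjointableOp A E) where
  norm_mul_self_le S := by
    rw [norm_def, norm_def]
    have hbd : ‖S.toCLM‖ ≤ √‖(star S * S).toCLM‖ := by
      refine ContinuousLinearMap.opNorm_le_bound _ (Real.sqrt_nonneg _) fun ξ => ?_
      refine le_of_sq_le_sq ?_ (by positivity)
      rw [mul_pow, Real.sq_sqrt (norm_nonneg _), CStarModule.norm_sq_eq A, S.inner_toCLM]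
      calc ‖inner A ξ (S.adj (S.toCLM ξ))‖ ≤ ‖ξ‖ * ‖S.adj (S.toCLM ξ)‖ :=
            CStarModule.norm_inner_le E
        _ ≤ ‖ξ‖ * (‖(star S * S).toCLM‖ * ‖ξ‖) := by
            gcongr
            exact (star S * S).toCLM.le_opNorm ξ
        _ = ‖(star S * S).toCLM‖ * ‖ξ‖ ^ 2 := by ring
    calc ‖S.toCLM‖ * ‖S.toCLM‖ ≤ √‖(star S * S).toCLM‖ * √‖(star S * S).toCLM‖ := by gcongr
      _ = ‖(star S * S).toCLM‖ := Real.mul_self_sqrt (norm_nonneg _)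

instance instCompleteSpace [CompleteSpace E] : CompleteSpace (AdjointableOp A E) := by
  have hiso : Isometry (toCLM : AdjointableOp A E → E →L[ℂ] E) :=
    AddMonoidHomClass.isometry_of_norm (toCLMHom : AdjointableOp A E →ₙ+* (E →L[ℂ] E))
      fun _ => rfl
  have hstar : ∀ S T : AdjointableOp A E, dist (star S) (star T) = dist S T := fun S T => by
    rw [dist_eq_norm, dist_eq_norm, ← star_sub, norm_star]
  have hadj : Isometry (adj : AdjointableOp A E → E →L[ℂ] E) :=
    Isometry.of_dist_eq fun S T => (hiso.dist_eq (star S) (star T)).trans (hstar S T)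
  refine Metric.complete_of_cauchySeq_tendsto fun u hu => ?_
  obtain ⟨T, hT⟩ := cauchySeq_tendsto_of_complete (hiso.uniformContinuous.comp_cauchySeq hu)
  obtain ⟨T', hT'⟩ := cauchySeq_tendsto_of_complete (hadj.uniformContinuous.comp_cauchySeq hu)
  have happ : ∀ {F : ℕ → E →L[ℂ] E} {L : E →L[ℂ] E}, Tendsto F atTop (𝓝 L) →
      ∀ ξ, Tendsto (fun n => F n ξ) atTop (𝓝 (L ξ)) := fun hF ξ =>
    ((ContinuousLinearMap.apply ℂ E ξ).continuous.tendsto _).comp hF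
  have hin : Continuous fun p : E × E => inner A p.1 p.2 := CStarModule.continuous_inner
  refine ⟨⟨T, T', fun ξ η => ?_⟩, ?_⟩
  · have h1 : Tendsto (fun n => inner A ((u n).toCLM ξ) η) atTop (𝓝 (inner A (T ξ) η)) :=
      (hin.tendsto (T ξ, η)).comp ((happ hT ξ).prodMk_nhds tendsto_const_nhds)
    have h2 : Tendsto (fun n => inner A ξ ((u n).adj η)) atTop (𝓝 (inner A ξ (T' η))) :=
      (hin.tendsto (ξ, T' η)).comp (tendsto_const_nhds.prodMk_nhds (happ hT' η))
    refine tendsto_nhds_unique h1 (h2.congr fun n => ?_)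
    rw [(u n).inner_toCLM]
  · rw [hiso.isEmbedding.tendsto_nhds_iff]
    exact hT

instance instNonUnitalCStarAlgebra [CompleteSpace E] :
    NonUnitalCStarAlgebra (AdjointableOp A E) where

theorem norm_smul_le (a : A) (ξ : E) : ‖a • ξ‖ ≤ ‖a‖ * ‖ξ‖ := by
  refine le_of_sq_le_sq ?_ (by have := norm_nonneg ξ; positivity)
  rw [CStarModule.norm_sq_eq A, mul_pow, CStarModule.norm_sq_eq A (x := ξ),
    CStarModule.inner_op_smul_right, CStarModule.inner_op_smul_left]
  calc ‖a * (inner A ξ ξ * star a)‖ ≤ ‖a‖ * (‖inner A ξ ξ‖ * ‖star a‖) :=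
        (norm_mul_le _ _).trans (by gcongr; exact norm_mul_le _ _)
    _ = ‖a‖ ^ 2 * ‖inner A ξ ξ‖ := by rw [norm_star]; ring

/-- The operator `|ξ⟩⟨η| : ζ ↦ ξ ⟨η | ζ⟩` as a bounded operator. -/
def rankOneCLM (A : Type*) {E : Type*} [NonUnitalCommCStarAlgebra A] [PartialOrder A]
    [StarOrderedRing A] [NormedAddCommGroup E] [NormedSpace ℂ E] [SMul A E] [CStarModule A E]
    (ξ η : E) : E →L[ℂ] E :=
  LinearMap.mkContinuous
    { toFun := fun ζ => inner A η ζ • ξ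
      map_add' := fun ζ ζ' => eq_of_inner_left (A := A) fun θ => by simp [add_mul]
      map_smul' := fun c ζ => eq_of_inner_left (A := A) fun θ => by simp [smul_mul_assoc] }
    (‖ξ‖ * ‖η‖) fun ζ => by
      refine (norm_smul_le (inner A η ζ) ξ).trans ?_
      have := CStarModule.norm_inner_le (A := A) E (x := η) (y := ζ)
      nlinarith [norm_nonneg ξ]

/-- The adjointable operator `|ξ⟩⟨η| : ζ ↦ ξ ⟨η | ζ⟩`, with adjoint `|η⟩⟨ξ|`. -/
def rankOne (A : Type*) {E : Type*} [NonUnitalCommCStarAlgebra A] [PartialOrder A]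
    [StarOrderedRing A] [NormedAddCommGroup E] [NormedSpace ℂ E] [SMul A E] [CStarModule A E]
    (ξ η : E) : AdjointableOp A E where
  toCLM := rankOneCLM A ξ η
  adj := rankOneCLM A η ξ
  inner_toCLM ζ θ := by
    change inner A (inner A η ζ • ξ) θ = inner A ζ (inner A ξ θ • η)
    simp

@[simp] theorem rankOne_toCLM (ξ η ζ : E) : (rankOne A ξ η).toCLM ζ = inner A η ζ • ξ := rfl
@[simp] theorem star_rankOne (ξ η : E) : star (rankOne A ξ η) = rankOne A η ξ := rfl

theorem toCLM_op_smul (T : AdjointableOp A E) (a : A) (ξ : E) :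
    T.toCLM (a • ξ) = a • T.toCLM ξ :=
  eq_of_inner_left (A := A) fun θ => by
    rw [← T.inner_adj, CStarModule.inner_op_smul_right, T.inner_adj,
      CStarModule.inner_op_smul_right]

theorem mul_rankOne (T : AdjointableOp A E) (ξ η : E) :
    T * rankOne A ξ η = rankOne A (T.toCLM ξ) η :=
  toCLM_injective (by ext ζ; simp [toCLM_op_smul])

/-- The `*`-algebra of finite-rank operators: the span of the operators `|ξ⟩⟨η|`. -/
def finiteRank (A E : Type*) [NonUnitalCommCStarAlgebra A] [PartialOrder A]
    [StarOrderedRing A] [NormedAddCommGroup E] [NormedSpace ℂ E] [SMul A E]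
    [CStarModule A E] : NonUnitalStarSubalgebra ℂ (AdjointableOp A E) where
  __ := Submodule.span ℂ {T : AdjointableOp A E | ∃ ξ η : E, T = rankOne A ξ η}
  mul_mem' := by
    intro S T _ hT
    change S * T ∈ Submodule.span ℂ {T : AdjointableOp A E | ∃ ξ η : E, T = rankOne A ξ η}
    induction hT using Submodule.span_induction with
    | mem T hT =>
      obtain ⟨ξ, η, rfl⟩ := hT
      exact Submodule.subset_span ⟨_, _, mul_rankOne S ξ η⟩
    | zero => rw [mul_zero]; exact Submodule.zero_mem _
    | add T T' _ _ h h' => rw [mul_add]; exact Submodule.add_mem _ h h'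
    | smul c T _ h => rw [mul_smul_comm]; exact Submodule.smul_mem _ c h
  star_mem' := by
    intro T hT
    change star T ∈ Submodule.span ℂ {T : AdjointableOp A E | ∃ ξ η : E, T = rankOne A ξ η}
    induction hT using Submodule.span_induction with
    | mem T hT =>
      obtain ⟨ξ, η, rfl⟩ := hT
      exact Submodule.subset_span ⟨_, _, star_rankOne ξ η⟩
    | zero => rw [star_zero]; exact Submodule.zero_mem _
    | add T T' _ _ h h' => rw [star_add]; exact Submodule.add_mem _ h h'
    | smul c T _ h => rw [star_smul]; exact Submodule.smul_mem _ _ h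

/-- The C⋆-algebra `K_A(E)` of compact operators: the operator-norm closure of the span of the
operators `|ξ⟩⟨η|`. -/
def compacts (A E : Type*) [NonUnitalCommCStarAlgebra A] [PartialOrder A]
    [StarOrderedRing A] [NormedAddCommGroup E] [NormedSpace ℂ E] [SMul A E]
    [CStarModule A E] : NonUnitalStarSubalgebra ℂ (AdjointableOp A E) :=
  (finiteRank A E).topologicalClosure

end AdjointableOp

/-! ### Twisted actions on Hilbert modules -/

/-- A twisted action of `W` on the Hilbert `C₀(X)`-module `E`.
As `C₀(X)` is commutative, the right action of `b ∈ C₀(X)` on `E` is written `b • ξ`.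
The field `mul` says that `U_v U_w ξ = U_{vw}(ξ) γ(v, w)^*`, where the (right) action of a unitary
multiplier `u` on `E` is characterised by `(ξ u) b = ξ (u b)` for all `b ∈ C₀(X)`. -/
structure TwistedModuleAction {W X : Type*} [Group W] [TopologicalSpace X] [MulAction W X]
    [ContinuousConstSMul W X] (γ : TwistingCocycle W X) (E : Type*)
    [NormedAddCommGroup E] [NormedSpace ℂ E] [SMul C₀(X, ℂ) E] [CStarModule C₀(X, ℂ) E] where
  U : W → (E ≃L[ℂ] E)
  map_smul : ∀ (w : W) (b : C₀(X, ℂ)) (ξ : E), U w (b • ξ) = C0.translate w b • U w ξ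
  inner_map : ∀ (w : W) (ξ η : E),
    inner C₀(X, ℂ) (U w ξ) (U w η) = C0.translate w (inner C₀(X, ℂ) ξ η)
  mul : ∀ (v w : W) (ξ : E) (b : C₀(X, ℂ)),
    b • U v (U w ξ) = C0.unitaryMul (γ v w)⁻¹ b • U (v * w) ξ

namespace TwistedModuleAction

variable {W X : Type*} [Group W] [TopologicalSpace X] [MulAction W X]
  [ContinuousConstSMul W X] {γ : TwistingCocycle W X} {E : Type*}
  [NormedAddCommGroup E] [NormedSpace ℂ E] [SMul C₀(X, ℂ) E] [CStarModule C₀(X, ℂ) E]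

theorem adj_comm (U : TwistedModuleAction γ E) {T : AdjointableOp C₀(X, ℂ) E} {w : W}
    (h : ∀ ξ, U.U w (T.toCLM ξ) = T.toCLM (U.U w ξ)) (ξ : E) :
    U.U w (T.adj ξ) = T.adj (U.U w ξ) := by
  refine AdjointableOp.eq_of_inner_left (A := C₀(X, ℂ)) fun ζ => ?_
  obtain ⟨ζ, rfl⟩ := (U.U w).surjective ζ
  rw [U.inner_map, ← T.inner_toCLM, ← T.inner_toCLM, ← h, U.inner_map]

/-- The fixed-point algebra `K_{C₀(X)}(E)^W`: the compact operators `k` with `U_w k = k U_w` for all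
`w`. -/
def fixedCompacts (U : TwistedModuleAction γ E) :
    NonUnitalStarSubalgebra ℂ (AdjointableOp C₀(X, ℂ) E) where
  carrier := {k | k ∈ AdjointableOp.compacts C₀(X, ℂ) E ∧
    ∀ (w : W) (ξ : E), U.U w (k.toCLM ξ) = k.toCLM (U.U w ξ)}
  add_mem' := fun ⟨h, h'⟩ ⟨k, k'⟩ => ⟨add_mem h k, fun w ξ => by simp [h', k']⟩
  zero_mem' := ⟨zero_mem _, fun w ξ => by simp⟩
  mul_mem' := fun ⟨h, h'⟩ ⟨k, k'⟩ => ⟨mul_mem h k, fun w ξ => by simp [h', k']⟩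
  smul_mem' := fun c _ ⟨h, h'⟩ => ⟨SMulMemClass.smul_mem c h, fun w ξ => by simp [h']⟩
  star_mem' := fun ⟨h, h'⟩ => ⟨star_mem h, fun w => U.adj_comm (h' w)⟩

instance isClosed_fixedCompacts (U : TwistedModuleAction γ E) :
    IsClosed (U.fixedCompacts : Set (AdjointableOp C₀(X, ℂ) E)) := by
  have hiso : Isometry (AdjointableOp.toCLM : AdjointableOp C₀(X, ℂ) E → E →L[ℂ] E) :=
    AddMonoidHomClass.isometry_of_norm
      (AdjointableOp.toCLMHom : AdjointableOp C₀(X, ℂ) E →ₙ+* (E →L[ℂ] E)) fun _ => rfl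
  have happ : ∀ ξ : E, Continuous fun k : AdjointableOp C₀(X, ℂ) E => k.toCLM ξ := fun ξ =>
    (ContinuousLinearMap.apply ℂ E ξ).continuous.comp hiso.continuous
  have h1 : IsClosed {k : AdjointableOp C₀(X, ℂ) E |
      ∀ (w : W) (ξ : E), U.U w (k.toCLM ξ) = k.toCLM (U.U w ξ)} := by
    simp only [Set.ofPred_forall]
    exact isClosed_iInter fun w => isClosed_iInter fun ξ =>
      isClosed_eq ((U.U w).continuous.comp (happ ξ)) (happ _)
  exact ((AdjointableOp.finiteRank C₀(X, ℂ) E).isClosed_topologicalClosure).inter h1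

/-- The natural left action of `K_{C₀(X)}(E)^W` on `E`. -/
def leftSMul (U : TwistedModuleAction γ E) (k : U.fixedCompacts) (ξ : E) : E :=
  (k : AdjointableOp C₀(X, ℂ) E).toCLM ξ

/-- The right action of `C₀(X) ⋊_γ W` on `E`, given by `ξ · b w = U_w⁻¹ (ξ b)`. -/
def rightSMul [Fintype W] (U : TwistedModuleAction γ E) (ξ : E) (f : TwistedCrossedProduct γ) : E :=
  ∑ w : W, (U.U w).symm (f.coeff w • ξ)

/-- The `C₀(X) ⋊_γ W`-valued inner product `⟪ξ | η⟫ = ∑ w, ⟨ξ | U_w η⟩ w` on `E`. -/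
def crossedInner (U : TwistedModuleAction γ E) (ξ η : E) : TwistedCrossedProduct γ :=
  TwistedCrossedProduct.mk fun w => inner C₀(X, ℂ) ξ (U.U w η)

end TwistedModuleAction

/-! ### Projective representations of finite groups -/

/-- A unitary `η`-representation of a group `G` on `H`:
`π(g₁) π(g₂) = η(g₁, g₂) π(g₁ g₂)`. -/
structure UnitaryProjRep (G : Type*) [Group G] (η : G → G → Circle) (H : Type*)
    [NormedAddCommGroup H] [InnerProductSpace ℂ H] where
  toFun : G → (H ≃ₗᵢ[ℂ] H)
  map_mul : ∀ (g₁ g₂ : G) (h : H), toFun g₁ (toFun g₂ h) = (η g₁ g₂ : ℂ) • toFun (g₁ * g₂) h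

/-- The complex conjugate of a Hilbert space: the same vectors, with the scalar `c` acting as
`conj c` and the inner product conjugated. -/
def ConjSpace (H : Type*) : Type _ := H

namespace ConjSpace

variable (H : Type*) [NormedAddCommGroup H] [InnerProductSpace ℂ H]

instance : NormedAddCommGroup (ConjSpace H) := inferInstanceAs (NormedAddCommGroup H)

/-- The additive identification `h ↦ h̄` of `H` with its conjugate. -/
def conj : H ≃+ ConjSpace H := AddEquiv.refl H

instance : Module ℂ (ConjSpace H) where
  smul c h := conj H (star c • (conj H).symm h)
  one_smul h := by
    change conj H (star (1 : ℂ) • (conj H).symm h) = h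
    simp
  mul_smul c d h := by
    change conj H (star (c * d) • (conj H).symm h) =
      conj H (star c • (conj H).symm (conj H (star d • (conj H).symm h)))
    simp [mul_smul]
  smul_zero c := by
    change conj H (star c • (conj H).symm 0) = 0
    simp
  smul_add c h k := by
    change conj H (star c • (conj H).symm (h + k)) =
      conj H (star c • (conj H).symm h) + conj H (star c • (conj H).symm k)
    simp
  add_smul c d h := by
    change conj H (star (c + d) • (conj H).symm h) =
      conj H (star c • (conj H).symm h) + conj H (star d • (conj H).symm h)
    simp [add_smul]
  zero_smul h := by
    change conj H (star (0 : ℂ) • (conj H).symm h) = 0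
    simp

theorem smul_conj (c : ℂ) (h : H) : c • conj H h = conj H (star c • h) := rfl

theorem norm_conj (h : H) : ‖conj H h‖ = ‖h‖ := rfl

instance : InnerProductSpace ℂ (ConjSpace H) where
  norm_smul_le c h := by
    obtain ⟨h, rfl⟩ := (conj H).surjective h
    rw [smul_conj, norm_conj, norm_conj, norm_smul, norm_star]
  inner h k := inner ℂ ((conj H).symm k) ((conj H).symm h)
  norm_sq_eq_re_inner h := norm_sq_eq_re_inner (𝕜 := ℂ) ((conj H).symm h)
  conj_inner_symm h k := inner_conj_symm _ _
  add_left h k l := by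
    change inner ℂ ((conj H).symm l) ((conj H).symm (h + k)) =
      inner ℂ ((conj H).symm l) ((conj H).symm h) + inner ℂ ((conj H).symm l) ((conj H).symm k)
    rw [map_add, inner_add_right]
  smul_left h k c := by
    change inner ℂ ((conj H).symm k) (star c • (conj H).symm h) =
      star c * inner ℂ ((conj H).symm k) ((conj H).symm h)
    rw [inner_smul_right]

theorem inner_conj (h k : H) : inner ℂ (conj H h) (conj H k) = inner ℂ k h := rfl

end ConjSpace

namespace UnitaryProjRep

variable {G : Type*} [Group G] {η : G → G → Circle} {H : Type*}
  [NormedAddCommGroup H] [InnerProductSpace ℂ H]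

/-- `H` is nonzero and has no proper nonzero `G`-invariant subspace. -/
def IsIrreducible (π : UnitaryProjRep G η H) : Prop :=
  Nontrivial H ∧ ∀ S : Submodule ℂ H, (∀ g, ∀ h ∈ S, π.toFun g h ∈ S) → S = ⊥ ∨ S = ⊤

/-- The contragredient of an `η`-representation `π`, an `η̄`-representation on the conjugate space:
`π̄(g) h̄` is the conjugate of `π(g) h`. -/
def contragredient (π : UnitaryProjRep G η H) : UnitaryProjRep G (η⁻¹) (ConjSpace H) where
  toFun g :=
    { toFun := fun h => ConjSpace.conj H (π.toFun g ((ConjSpace.conj H).symm h))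
      invFun := fun h => ConjSpace.conj H ((π.toFun g).symm ((ConjSpace.conj H).symm h))
      left_inv := fun h => by simp
      right_inv := fun h => by simp
      map_add' := fun h k => by simp
      map_smul' := fun c h => by
        obtain ⟨h, rfl⟩ := (ConjSpace.conj H).surjective h
        simp [ConjSpace.smul_conj]
      norm_map' := fun h => (π.toFun g).norm_map ((ConjSpace.conj H).symm h) }
  map_mul g₁ g₂ h := by
    obtain ⟨h, rfl⟩ := (ConjSpace.conj H).surjective h
    change ConjSpace.conj H (π.toFun g₁ (π.toFun g₂ h)) =
      _ • ConjSpace.conj H (π.toFun (g₁ * g₂) h)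
    rw [π.map_mul, ConjSpace.smul_conj]
    congr 2
    change (η g₁ g₂ : ℂ) = star (((η g₁ g₂)⁻¹ : Circle) : ℂ)
    rw [Circle.coe_inv_eq_conj]
    exact (star_star (η g₁ g₂ : ℂ)).symm

/-- `π` occurs in `σ`: it is isomorphic to a subrepresentation of `σ`. -/
def OccursIn {η' : G → G → Circle} {K : Type*} [NormedAddCommGroup K] [InnerProductSpace ℂ K]
    (π : UnitaryProjRep G η H) (σ : UnitaryProjRep G η' K) : Prop :=
  ∃ T : H →ₗᵢ[ℂ] K, ∀ g h, T (π.toFun g h) = σ.toFun g (T h)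

end UnitaryProjRep

/-! ### The fibres of a Hilbert `C₀(X)`-module and the local intertwiners -/

section Fibre

variable {X : Type*} [TopologicalSpace X] (E : Type*) [NormedAddCommGroup E] [NormedSpace ℂ E]
  [SMul C₀(X, ℂ) E] [CStarModule C₀(X, ℂ) E]

/-- The space `E` with the semi-inner product `⟨ξ | η⟩(x)`. -/
@[nolint unusedArguments]
def PreFibre (_x : X) : Type _ := E

namespace PreFibre

variable (x : X)

instance : AddCommGroup (PreFibre E x) := inferInstanceAs (AddCommGroup E)
instance : Module ℂ (PreFibre E x) := inferInstanceAs (Module ℂ E)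

/-- The identity map from `E` to `PreFibre E x`. -/
def of : E ≃ₗ[ℂ] PreFibre E x := LinearEquiv.refl ℂ E

/-- The semi-inner product `⟨ξ | η⟩(x)`. -/
abbrev core : PreInnerProductSpace.Core ℂ (PreFibre E x) where
  inner ξ η := inner C₀(X, ℂ) ((of E x).symm ξ) ((of E x).symm η) x
  conj_inner_symm ξ η := by
    rw [← CStarModule.star_inner ((of E x).symm η) ((of E x).symm ξ)]
    rfl
  re_inner_nonneg ξ := by
    obtain ⟨b, hb⟩ := CStarAlgebra.nonneg_iff_eq_star_mul_self.1
      (CStarModule.inner_self_nonneg (A := C₀(X, ℂ)) (x := (of E x).symm ξ))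
    rw [hb]
    change 0 ≤ ((starRingEnd ℂ) (b x) * b x).re
    rw [mul_comm, Complex.mul_conj]
    exact Complex.normSq_nonneg _
  add_left ξ η ζ := by
    rw [map_add, CStarModule.inner_add_left]
    rfl
  smul_left ξ η c := by
    rw [map_smul, CStarModule.inner_smul_left_complex]
    rfl

instance : SeminormedAddCommGroup (PreFibre E x) :=
  InnerProductSpace.Core.toSeminormedAddCommGroup (c := core E x)
instance : InnerProductSpace ℂ (PreFibre E x) := InnerProductSpace.ofCore (core E x)

theorem inner_def (ξ η : E) :
    inner ℂ (of E x ξ) (of E x η) = inner C₀(X, ℂ) ξ η x := rfl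

end PreFibre

/-- The fibre `E_x = E ⊗_{C₀(X)} ℂ_x`.  As `ξ ⊗ z = zξ ⊗ 1` and
`⟨ξ ⊗ 1 | η ⊗ 1⟩ = ⟨ξ | η⟩(x)`, this is the Hausdorff completion of `E` for the semi-inner product
`⟨ξ | η⟩(x)`. -/
abbrev Fibre (x : X) : Type _ := UniformSpace.Completion (PreFibre E x)

variable {E}

/-- The element `ξ(x) = ξ ⊗ 1` of `E_x`. -/
def Fibre.eval (x : X) (ξ : E) : Fibre E x := ((PreFibre.of E x ξ : PreFibre E x) : Fibre E x)

end Fibre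

/-- The extension of a unitary operator to Hausdorff completions. -/
def completionIsometryEquiv {V V' : Type*} [SeminormedAddCommGroup V] [InnerProductSpace ℂ V]
    [SeminormedAddCommGroup V'] [InnerProductSpace ℂ V'] (f : V ≃ₗᵢ[ℂ] V') :
    UniformSpace.Completion V ≃ₗᵢ[ℂ] UniformSpace.Completion V' where
  toLinearEquiv :=
    { (f.toContinuousLinearEquiv : V →L[ℂ] V').completion.toLinearMap with
      invFun := (f.symm.toContinuousLinearEquiv : V' →L[ℂ] V).completion
      left_inv := fun a => by
        change (f.symm.toContinuousLinearEquiv : V' →L[ℂ] V).completion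
          ((f.toContinuousLinearEquiv : V →L[ℂ] V').completion a) = a
        induction a using UniformSpace.Completion.induction_on with
        | hp => exact isClosed_eq (by fun_prop) (by fun_prop)
        | ih a => simp
      right_inv := fun a => by
        change (f.toContinuousLinearEquiv : V →L[ℂ] V').completion
          ((f.symm.toContinuousLinearEquiv : V' →L[ℂ] V).completion a) = a
        induction a using UniformSpace.Completion.induction_on with
        | hp => exact isClosed_eq (by fun_prop) (by fun_prop)
        | ih a => simp }
  norm_map' a := by
    change ‖(f.toContinuousLinearEquiv : V →L[ℂ] V').completion a‖ = ‖a‖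
    induction a using UniformSpace.Completion.induction_on with
    | hp => exact isClosed_eq (by fun_prop) (by fun_prop)
    | ih a => simp

theorem completionIsometryEquiv_coe {V V' : Type*} [SeminormedAddCommGroup V]
    [InnerProductSpace ℂ V] [SeminormedAddCommGroup V'] [InnerProductSpace ℂ V']
    (f : V ≃ₗᵢ[ℂ] V') (a : V) :
    completionIsometryEquiv f (a : UniformSpace.Completion V) = (f a : V') :=
  ContinuousLinearMap.completion_apply_coe (f.toContinuousLinearEquiv : V →L[ℂ] V') a

namespace TwistedModuleAction

section Local

variable {W X : Type*} [Group W] [TopologicalSpace X] [MulAction W X]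
  [ContinuousConstSMul W X] {γ : TwistingCocycle W X} {E : Type*}
  [NormedAddCommGroup E] [NormedSpace ℂ E] [SMul C₀(X, ℂ) E] [CStarModule C₀(X, ℂ) E]

/-- `U_w`, as an operator between the spaces `E` with the semi-inner products at `x` and at
`y = w x`. -/
def preIntertwiner (U : TwistedModuleAction γ E) (w : W) {x y : X} (h : w • x = y) :
    PreFibre E x ≃ₗᵢ[ℂ] PreFibre E y where
  toLinearEquiv := ((PreFibre.of E x).symm.trans (U.U w).toLinearEquiv).trans (PreFibre.of E y)
  norm_map' ξ := by
    obtain ⟨ξ, rfl⟩ := (PreFibre.of E x).surjective ξ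
    have h1 : inner ℂ (PreFibre.of E y (U.U w ξ)) (PreFibre.of E y (U.U w ξ)) =
        inner ℂ (PreFibre.of E x ξ) (PreFibre.of E x ξ) := by
      rw [PreFibre.inner_def, PreFibre.inner_def, U.inner_map, C0.translate_apply, ← h,
        inv_smul_smul]
    rw [norm_eq_sqrt_re_inner (𝕜 := ℂ), norm_eq_sqrt_re_inner (𝕜 := ℂ), ← h1]
    rfl

/-- The unitary operator `I_{w,x} : E_x → E_y`, `y = w x`, with `I_{w,x}(ξ(x)) = (U_w ξ)(w x)`. -/
def intertwiner (U : TwistedModuleAction γ E) (w : W) {x y : X} (h : w • x = y) :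
    Fibre E x ≃ₗᵢ[ℂ] Fibre E y :=
  completionIsometryEquiv (U.preIntertwiner w h)

theorem intertwiner_eval (U : TwistedModuleAction γ E) (w : W) {x y : X} (h : w • x = y) (ξ : E) :
    U.intertwiner w h (Fibre.eval x ξ) = Fibre.eval y (U.U w ξ) :=
  completionIsometryEquiv_coe _ _

theorem inner_mul_apply (U : TwistedModuleAction γ E) (v w : W) (ξ ζ : E) (x : X) :
    inner C₀(X, ℂ) ζ (U.U v (U.U w ξ)) x =
      (((γ v w x)⁻¹ : Circle) : ℂ) * inner C₀(X, ℂ) ζ (U.U (v * w) ξ) x := by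
  have hb : ∀ b : C₀(X, ℂ), b x * inner C₀(X, ℂ) ζ (U.U v (U.U w ξ)) x =
      (((γ v w x)⁻¹ : Circle) : ℂ) * b x * inner C₀(X, ℂ) ζ (U.U (v * w) ξ) x := by
    intro b
    have h := congrArg (fun θ => inner C₀(X, ℂ) ζ θ x) (U.mul v w ξ b)
    simp only [CStarModule.inner_op_smul_right] at h
    exact h
  have h1 := hb (star (inner C₀(X, ℂ) ζ (U.U v (U.U w ξ))))
  have h2 := hb (star (inner C₀(X, ℂ) ζ (U.U (v * w) ξ)))
  rw [ZeroAtInftyContinuousMap.star_apply] at h1 h2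
  set p := inner C₀(X, ℂ) ζ (U.U v (U.U w ξ)) x
  set q := inner C₀(X, ℂ) ζ (U.U (v * w) ξ) x
  set c : ℂ := (((γ v w x)⁻¹ : Circle) : ℂ)
  have h3 : (p - c * q) * star (p - c * q) = 0 := by
    rw [star_sub, star_mul]
    linear_combination h1 - star c * h2
  rcases mul_eq_zero.1 h3 with h4 | h4
  · exact sub_eq_zero.1 h4
  · exact sub_eq_zero.1 (star_eq_zero.1 h4)

theorem eval_smul (x : X) (c : ℂ) (ξ : E) : Fibre.eval x (c • ξ) = c • Fibre.eval x ξ :=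
  UniformSpace.Completion.coe_smul c (PreFibre.of E x ξ)

theorem eval_eq_of_inner_eq (x : X) (ξ ξ' : E)
    (h : ∀ ζ : E, inner C₀(X, ℂ) ζ ξ x = inner C₀(X, ℂ) ζ ξ' x) :
    Fibre.eval x ξ = Fibre.eval x ξ' := by
  have h1 : inner C₀(X, ℂ) (ξ - ξ') (ξ - ξ') x = 0 := by
    rw [CStarModule.inner_sub_right]
    exact sub_eq_zero.2 (h _)
  have h2 : ‖PreFibre.of E x (ξ - ξ')‖ = 0 := by
    rw [norm_eq_sqrt_re_inner (𝕜 := ℂ), PreFibre.inner_def, h1]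
    simp
  rw [← sub_eq_zero, ← norm_eq_zero, ← h2, map_sub]
  have h3 := UniformSpace.Completion.norm_coe (PreFibre.of E x ξ - PreFibre.of E x ξ')
  rw [UniformSpace.Completion.coe_sub] at h3
  exact h3

theorem eval_mul (U : TwistedModuleAction γ E) (v w : W) (ξ : E) (x : X) :
    Fibre.eval x (U.U v (U.U w ξ)) =
      (((γ v w x)⁻¹ : Circle) : ℂ) • Fibre.eval x (U.U (v * w) ξ) := by
  rw [← eval_smul]
  refine eval_eq_of_inner_eq x _ _ fun ζ => ?_
  rw [U.inner_mul_apply, CStarModule.inner_smul_right_complex]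
  rfl

theorem localRep_mul (U : TwistedModuleAction γ E) (x : X) {v w : W} (h₁ : v • x = x)
    (h₂ : w • x = x) (h₃ : (v * w) • x = x) (a : Fibre E x) :
    U.intertwiner v h₁ (U.intertwiner w h₂ a) =
      (((γ v w x)⁻¹ : Circle) : ℂ) • U.intertwiner (v * w) h₃ a := by
  induction a using UniformSpace.Completion.induction_on with
  | hp =>
    exact isClosed_eq ((U.intertwiner v h₁).continuous.comp (U.intertwiner w h₂).continuous)
      ((continuous_const_smul (((γ v w x)⁻¹ : Circle) : ℂ)).comp
        (U.intertwiner (v * w) h₃).continuous)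
  | ih a =>
    obtain ⟨ξ, rfl⟩ := (PreFibre.of E x).surjective a
    change U.intertwiner v h₁ (U.intertwiner w h₂ (Fibre.eval x ξ)) =
      _ • U.intertwiner (v * w) h₃ (Fibre.eval x ξ)
    rw [U.intertwiner_eval, U.intertwiner_eval, U.intertwiner_eval]
    exact U.eval_mul v w ξ x

/-- The local representation `I_x : w ↦ I_{w,x}` of the stabiliser `W_x` on `E_x`; it is a unitary
`γ̄_x`-representation. -/
def localRep (U : TwistedModuleAction γ E) (x : X) :
    UnitaryProjRep (MulAction.stabilizer W x) (fun v w => (γ v w x)⁻¹) (Fibre E x) where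
  toFun w := U.intertwiner (w : W) w.2
  map_mul v w := U.localRep_mul x (h₁ := v.2) (h₂ := w.2) (h₃ := (v * w).2)

end Local

end TwistedModuleAction

/-! ### Morita equivalence -/

/-- `E`, with the right action and the `B`-valued inner product given (linear in the second
variable), is a right Hilbert `B`-module. -/
structure IsRightHilbertModule {B E : Type*} [NonUnitalCStarAlgebra B] [AddCommGroup E]
    [Module ℂ E] (rsmul : E → B → E) (rinner : E → E → B) : Prop where
  add_smul : ∀ (x y : E) (b : B), rsmul (x + y) b = rsmul x b + rsmul y b
  smul_add : ∀ (x : E) (b c : B), rsmul x (b + c) = rsmul x b + rsmul x c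
  smul_mul : ∀ (x : E) (b c : B), rsmul x (b * c) = rsmul (rsmul x b) c
  scalar_smul : ∀ (z : ℂ) (x : E) (b : B), rsmul (z • x) b = z • rsmul x b
  smul_scalar : ∀ (z : ℂ) (x : E) (b : B), rsmul x (z • b) = z • rsmul x b
  inner_add : ∀ x y z : E, rinner x (y + z) = rinner x y + rinner x z
  inner_scalar : ∀ (c : ℂ) (x y : E), rinner x (c • y) = c • rinner x y
  inner_smul : ∀ (x y : E) (b : B), rinner x (rsmul y b) = rinner x y * b
  star_inner : ∀ x y : E, star (rinner x y) = rinner y x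
  inner_self_nonneg : ∀ x : E, ∃ b : B, rinner x x = star b * b
  inner_self_eq_zero : ∀ x : E, rinner x x = 0 → x = 0
  complete : ∀ u : ℕ → E,
    (∀ ε > 0, ∃ N, ∀ m ≥ N, ∀ n ≥ N, √‖rinner (u m - u n) (u m - u n)‖ < ε) →
    ∃ x, Tendsto (fun n => √‖rinner (u n - x) (u n - x)‖) atTop (𝓝 0)

/-- `E`, with the left action and the `A`-valued inner product given (linear in the first
variable), is a left Hilbert `A`-module. -/
structure IsLeftHilbertModule {A E : Type*} [NonUnitalCStarAlgebra A] [AddCommGroup E]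
    [Module ℂ E] (lsmul : A → E → E) (linner : E → E → A) : Prop where
  smul_add : ∀ (a : A) (x y : E), lsmul a (x + y) = lsmul a x + lsmul a y
  add_smul : ∀ (a b : A) (x : E), lsmul (a + b) x = lsmul a x + lsmul b x
  mul_smul : ∀ (a b : A) (x : E), lsmul (a * b) x = lsmul a (lsmul b x)
  smul_scalar : ∀ (z : ℂ) (a : A) (x : E), lsmul a (z • x) = z • lsmul a x
  scalar_smul : ∀ (z : ℂ) (a : A) (x : E), lsmul (z • a) x = z • lsmul a x
  inner_add : ∀ x y z : E, linner (x + y) z = linner x z + linner y z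
  inner_scalar : ∀ (c : ℂ) (x y : E), linner (c • x) y = c • linner x y
  inner_smul : ∀ (a : A) (x y : E), linner (lsmul a x) y = a * linner x y
  star_inner : ∀ x y : E, star (linner x y) = linner y x
  inner_self_nonneg : ∀ x : E, ∃ a : A, linner x x = star a * a
  inner_self_eq_zero : ∀ x : E, linner x x = 0 → x = 0
  complete : ∀ u : ℕ → E,
    (∀ ε > 0, ∃ N, ∀ m ≥ N, ∀ n ≥ N, √‖linner (u m - u n) (u m - u n)‖ < ε) →
    ∃ x, Tendsto (fun n => √‖linner (u n - x) (u n - x)‖) atTop (𝓝 0)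

/-- `E` is an `A`-`B` imprimitivity bimodule: a full left Hilbert `A`-module and a full right
Hilbert `B`-module for commuting actions, such that each algebra acts by adjointable operators for
the inner product of the other, and `⟨x, y⟩_A z = x ⟨y, z⟩_B`. -/
structure IsImprimitivityBimodule {A B E : Type*} [NonUnitalCStarAlgebra A]
    [NonUnitalCStarAlgebra B] [AddCommGroup E] [Module ℂ E] (lsmul : A → E → E)
    (linner : E → E → A) (rsmul : E → B → E) (rinner : E → E → B) : Prop where
  left : IsLeftHilbertModule lsmul linner
  right : IsRightHilbertModule rsmul rinner
  smul_comm : ∀ (a : A) (x : E) (b : B), lsmul a (rsmul x b) = rsmul (lsmul a x) b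
  left_full : Dense (Submodule.span ℂ {a : A | ∃ x y : E, a = linner x y} : Set A)
  right_full : Dense (Submodule.span ℂ {b : B | ∃ x y : E, b = rinner x y} : Set B)
  rinner_lsmul : ∀ (a : A) (x y : E), rinner (lsmul a x) y = rinner x (lsmul (star a) y)
  linner_rsmul : ∀ (b : B) (x y : E), linner (rsmul x b) y = linner x (rsmul y (star b))
  linner_smul : ∀ x y z : E, lsmul (linner x y) z = rsmul x (rinner y z)

/-- The `A`-`B` bimodule `E` with the given `B`-valued inner product is a Morita equivalence between
`A` and `B`: for some `A`-valued inner product (which is then uniquely determined) it is an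
imprimitivity bimodule. -/
def IsMoritaEquivalence {A B E : Type*} [NonUnitalCStarAlgebra A]
    [NonUnitalCStarAlgebra B] [AddCommGroup E] [Module ℂ E] (lsmul : A → E → E)
    (rsmul : E → B → E) (rinner : E → E → B) : Prop :=
  ∃ linner : E → E → A, IsImprimitivityBimodule lsmul linner rsmul rinner

end

universe v

/-! Everything in the definition of a Morita equivalence except fullness on the right holds for
every twisted action. The candidate for the left inner product is the average `∑ w, |U_w ξ⟩⟨U_w η|`.
It commutes with `W` because the phases of the cocycle cancel between ket and bra. Averaging
finite-rank operators over `W` shows that it is always full. Positivity of both inner products comes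
from one criterion, `exists_eq_star_mul_self_of_conjugates`: conjugating an inner square gives
another inner square, and a nonzero one cannot be of the form `-(c⋆ c)`. For the crossed product
this is read off from the coefficient at `1`, for the fixed-point algebra from quadratic forms. So
the theorem reduces to density of the span `J` of the crossed-product inner products
(`isMoritaEquivalence_iff_dense`).

Density of `J` is a local question. It is equivalent to `MatrixCoeffsSpan` at every `x`: the matrix
coefficients `w ↦ ⟨ξ | U_w η⟩(x)` of `I_x` span all functions on the stabiliser `W_x`. A linear
relation among them at `x` is a continuous functional on the crossed product that vanishes on `J`,
so density excludes it. Conversely, `J` is a two-sided ideal. Right multiplication by bump functions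
that separate the orbit of `x` carries prescribed values on `W_x` to prescribed values on all of
`W`, and left multiplication by a partition of unity glues the local solutions
(`dense_of_matrixCoeffsSpan`).

At a fixed `x` the remaining statement concerns a finite group: the matrix coefficients of `I_x`
span if and only if every irreducible `γ_x`-representation occurs in the contragredient. If `π` does
not occur, Schur's lemma annihilates all averaged rank-one operators, which makes the coefficients
of `π` a relation among those of `I_x`. Conversely, a relation `c` says that `∑ c_w I_w = 0`. Its
conjugate then vanishes in every irreducible `γ_x`-representation, whereas these separate the
twisted group algebra, as the left regular representation shows. -/

noncomputable section

/-! ### Projective unitary representations of finite groups -/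

namespace UnitaryProjRep

section

variable {G : Type*} [Group G] {η η' : G → G → Circle} {H K : Type*}
  [NormedAddCommGroup H] [InnerProductSpace ℂ H] [NormedAddCommGroup K] [InnerProductSpace ℂ K]

/-- The cocycle only contributes scalars, so the span of the finite orbit of one nonzero vector is
invariant, hence everything. -/
theorem IsIrreducible.finiteDimensional [Finite G] {π : UnitaryProjRep G η H}
    (hπ : π.IsIrreducible) : FiniteDimensional ℂ H := by
  obtain ⟨hnt, hS⟩ := hπ
  obtain ⟨h₀, hh₀⟩ := exists_ne (0 : H)
  have hinv : ∀ g, ∀ h ∈ Submodule.span ℂ (Set.range fun g => π.toFun g h₀),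
      π.toFun g h ∈ Submodule.span ℂ (Set.range fun g => π.toFun g h₀) := by
    intro g h hh
    induction hh using Submodule.span_induction with
    | mem h hh =>
      obtain ⟨k, rfl⟩ := hh
      rw [π.map_mul]
      exact Submodule.smul_mem _ _ (Submodule.subset_span ⟨_, rfl⟩)
    | zero => rw [map_zero]; exact Submodule.zero_mem _
    | add h k _ _ hh hk => rw [map_add]; exact Submodule.add_mem _ hh hk
    | smul c h _ hh => rw [map_smul]; exact Submodule.smul_mem _ _ hh
  rcases hS _ hinv with h | h
  · rw [Submodule.span_eq_bot] at h
    have h1 := h _ ⟨1, rfl⟩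
    exact absurd ((π.toFun 1).map_eq_zero_iff.1 h1) hh₀
  · exact Module.finite_def.2 (h ▸ Submodule.fg_span (Set.finite_range _))

/-- Schur's lemma: a nonzero intertwiner defined on an irreducible representation is a multiple
of an isometry. -/
theorem IsIrreducible.occursIn_of_intertwiner [Finite G] {π : UnitaryProjRep G η H}
    (hπ : π.IsIrreducible) (σ : UnitaryProjRep G η' K) (T : H →ₗ[ℂ] K)
    (hT : ∀ g h, T (π.toFun g h) = σ.toFun g (T h)) (hne : T ≠ 0) : π.OccursIn σ := by
  have := hπ.finiteDimensional
  have := hπ.1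
  -- This is `T⋆T`. The codomain is cut down to the finite-dimensional range because `K` need not be
  -- complete, so `T` itself need not have an adjoint.
  set S : H →ₗ[ℂ] H := LinearMap.adjoint T.rangeRestrict ∘ₗ T.rangeRestrict with hSdef
  have hS : ∀ h k, inner ℂ h (S k) = inner ℂ (T h) (T k) := fun h k => by
    rw [hSdef, LinearMap.comp_apply, LinearMap.adjoint_inner_right]
    rfl
  have hcomm : ∀ g h, S (π.toFun g h) = π.toFun g (S h) := fun g h => by
    refine ext_inner_left ℂ fun k => ?_
    obtain ⟨k, rfl⟩ := (π.toFun g).surjective k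
    rw [hS, hT, hT, LinearIsometryEquiv.inner_map_map, LinearIsometryEquiv.inner_map_map, hS]
  obtain ⟨μ, hμ⟩ := Module.End.exists_eigenvalue (K := ℂ) S
  have htop : Module.End.eigenspace S μ = ⊤ := by
    refine (hπ.2 (Module.End.eigenspace S μ) fun g h hh => ?_).resolve_left hμ
    rw [Module.End.mem_eigenspace_iff] at hh ⊢
    rw [hcomm, hh, map_smul]
  -- From `T⋆T = μ` one gets `‖T h‖² = μ ‖h‖²`; taking norms avoids a separate proof that `μ` is
  -- real and nonnegative.
  have hnorm : ∀ h, ‖T h‖ = √‖μ‖ * ‖h‖ := fun h => by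
    have h1 : S h = μ • h := Module.End.mem_eigenspace_iff.1 (htop ▸ Submodule.mem_top)
    have h2 := hS h h
    rw [h1, inner_smul_right, inner_self_eq_norm_sq_to_K, inner_self_eq_norm_sq_to_K] at h2
    have h3 := congrArg norm h2
    simp only [norm_mul, norm_pow, RCLike.norm_ofReal, abs_norm] at h3
    rw [← Real.sqrt_sq (norm_nonneg (T h)), ← h3, Real.sqrt_mul (norm_nonneg _),
      Real.sqrt_sq (norm_nonneg _)]
  have hμ0 : √‖μ‖ ≠ 0 := fun h0 => hne <| LinearMap.ext fun h => by
    have := hnorm h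
    rw [h0, zero_mul, norm_eq_zero] at this
    simpa using this
  refine ⟨⟨((√‖μ‖ : ℂ)⁻¹) • T, fun h => ?_⟩, fun g h => ?_⟩
  · rw [LinearMap.smul_apply, norm_smul, hnorm, norm_inv, Complex.norm_real, Real.norm_eq_abs,
      abs_of_nonneg (Real.sqrt_nonneg _), inv_mul_cancel_left₀ hμ0]
  · change (√‖μ‖ : ℂ)⁻¹ • T (π.toFun g h) = σ.toFun g ((√‖μ‖ : ℂ)⁻¹ • T h)
    rw [hT, map_smul]

/-- The intertwiner from `π` to `σ` obtained by averaging the rank one operator `|v⟩⟨h|`. -/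
def averagedRankOne [Fintype G] (π : UnitaryProjRep G η H) (σ : UnitaryProjRep G η' K)
    (v : K) (h : H) : H →ₗ[ℂ] K where
  toFun k := ∑ g, (σ.toFun g).symm (inner ℂ h (π.toFun g k) • v)
  map_add' k l := by
    rw [← Finset.sum_add_distrib]
    refine Finset.sum_congr rfl fun g _ => ?_
    rw [map_add, inner_add_right, add_smul, map_add]
  map_smul' c k := by
    rw [Finset.smul_sum]
    refine Finset.sum_congr rfl fun g _ => ?_
    rw [map_smul (π.toFun g), inner_smul_right, mul_smul, map_smul (σ.toFun g).symm]
    rfl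

theorem averagedRankOne_apply [Fintype G] (π : UnitaryProjRep G η H) (σ : UnitaryProjRep G η' K)
    (v : K) (h k : H) : averagedRankOne π σ v h k =
      ∑ g, (σ.toFun g).symm (inner ℂ h (π.toFun g k) • v) := rfl

/-- Coefficients of an averaged operator are pairings of a matrix coefficient of `σ` with one of
`π`; this turns the absence of intertwiners into orthogonality relations. -/
theorem inner_averagedRankOne [Fintype G] (π : UnitaryProjRep G η H)
    (σ : UnitaryProjRep G η' K) (v w : K) (h k : H) :
    inner ℂ w (averagedRankOne π σ v h k) =
      ∑ g, inner ℂ (σ.toFun g w) v * inner ℂ h (π.toFun g k) := by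
  rw [averagedRankOne_apply, inner_sum]
  refine Finset.sum_congr rfl fun g _ => ?_
  rw [← LinearIsometryEquiv.inner_map_map (σ.toFun g), LinearIsometryEquiv.apply_symm_apply,
    inner_smul_right, mul_comm]

/-- Substitute `g ↦ g u` in the sum. The scalar `η(g, u)` arising from `π` equals the one arising
from `σ`, which is why the two cocycles must agree. -/
theorem averagedRankOne_intertwines [Fintype G] (π : UnitaryProjRep G η H)
    (σ : UnitaryProjRep G η' K) (hη : ∀ g₁ g₂, η' g₁ g₂ = η g₁ g₂) (v : K) (h : H) (u : G)
    (k : H) :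
    averagedRankOne π σ v h (π.toFun u k) = σ.toFun u (averagedRankOne π σ v h k) := by
  rw [averagedRankOne_apply, averagedRankOne_apply, map_sum]
  refine Fintype.sum_equiv (Equiv.mulRight u) _ _ fun g => ?_
  apply (σ.toFun g).injective
  rw [LinearIsometryEquiv.apply_symm_apply, σ.map_mul, Equiv.coe_mulRight,
    LinearIsometryEquiv.apply_symm_apply, π.map_mul, inner_smul_right, hη, mul_smul]

/-- The restriction of a representation to an invariant subspace of finite dimension. -/
def restrict (π : UnitaryProjRep G η H) (S : Submodule ℂ H) [FiniteDimensional ℂ S]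
    (hS : ∀ g, ∀ h ∈ S, π.toFun g h ∈ S) : UnitaryProjRep G η S where
  toFun g := LinearIsometry.toLinearIsometryEquiv
    (⟨((π.toFun g).toLinearEquiv : H →ₗ[ℂ] H).restrict (hS g),
      fun h => (π.toFun g).norm_map h⟩ : S →ₗᵢ[ℂ] S) rfl
  map_mul g₁ g₂ h := Subtype.ext (π.map_mul g₁ g₂ h)

theorem coe_restrict (π : UnitaryProjRep G η H) (S : Submodule ℂ H) [FiniteDimensional ℂ S]
    (hS : ∀ g, ∀ h ∈ S, π.toFun g h ∈ S) (g : G) (h : S) :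
    ((π.restrict S hS).toFun g h : H) = π.toFun g h := rfl

/-- Choose `S` minimal among the invariant subspaces on which `∑ a_g π(g)` is nonzero. A proper
nonzero invariant `T` inside `S` would split `S` into `T` and its complement, both smaller, and the
operator would vanish on each of them. -/
theorem exists_irreducible_restrict [Fintype G] [FiniteDimensional ℂ H]
    (π : UnitaryProjRep G η H) (a : G → ℂ) (h₀ : H) (hh₀ : ∑ g, a g • π.toFun g h₀ ≠ 0) :
    ∃ (S : Submodule ℂ H) (hS : ∀ g, ∀ h ∈ S, π.toFun g h ∈ S),
      (π.restrict S hS).IsIrreducible ∧ ∃ h : S, ∑ g, a g • (π.restrict S hS).toFun g h ≠ 0 := by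
  obtain ⟨S, ⟨hS, h, hhS, hh⟩, hmin⟩ := (wellFounded_lt (α := Submodule ℂ H)).has_min
    {S | (∀ g, ∀ h ∈ S, π.toFun g h ∈ S) ∧ ∃ h ∈ S, ∑ g, a g • π.toFun g h ≠ 0}
    ⟨⊤, fun _ _ _ => Submodule.mem_top, h₀, Submodule.mem_top, hh₀⟩
  have hvan : ∀ T : Submodule ℂ H, T < S → (∀ g, ∀ h ∈ T, π.toFun g h ∈ T) →
      ∀ h ∈ T, ∑ g, a g • π.toFun g h = 0 := fun T hTS hT k hk => by
    by_contra hk0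
    exact hmin T ⟨hT, k, hk, hk0⟩ hTS
  have hsimple : ∀ T : Submodule ℂ H, T ≤ S → (∀ g, ∀ h ∈ T, π.toFun g h ∈ T) →
      T = ⊥ ∨ T = S := by
    intro T hTS hT
    by_contra! hcon
    obtain ⟨hbot, hne⟩ := hcon
    have hTperp : ∀ g, ∀ k ∈ Tᗮ, π.toFun g k ∈ Tᗮ := by
      intro g k hk
      rw [Submodule.mem_orthogonal] at hk ⊢
      intro t ht
      -- Invariance of the complement needs `π(g) T = T`, not just inclusion; in finite dimension
      -- the restricted isometry is onto.
      have hsurj : ∃ s ∈ T, π.toFun g s = t := by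
        obtain ⟨s, hs⟩ := ((π.restrict T hT).toFun g).surjective ⟨t, ht⟩
        exact ⟨s, s.2, congrArg Subtype.val hs⟩
      obtain ⟨s, hs, rfl⟩ := hsurj
      rw [LinearIsometryEquiv.inner_map_map]
      exact hk s hs
    have hlt : S ⊓ Tᗮ < S := by
      refine lt_of_le_of_ne inf_le_left fun heq => hbot ?_
      rw [inf_eq_left] at heq
      exact (Submodule.eq_bot_iff _).2 fun t ht =>
        inner_self_eq_zero.1 ((Submodule.mem_orthogonal _ _).1 (heq (hTS ht)) t ht)
    have h1 := hvan T (lt_of_le_of_ne hTS hne) hT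
    have h2 := hvan (S ⊓ Tᗮ) hlt fun g k hk => ⟨hS g k hk.1, hTperp g k hk.2⟩
    obtain ⟨t, ht, p, hp, rfl⟩ := T.exists_add_mem_mem_orthogonal h
    have hpS : p ∈ S := by
      have := S.sub_mem hhS (hTS ht)
      rwa [add_sub_cancel_left] at this
    refine hh ?_
    simp only [map_add, smul_add, Finset.sum_add_distrib]
    rw [h1 t ht, h2 p ⟨hpS, hp⟩, add_zero]
  refine ⟨S, hS, ⟨⟨⟨h, hhS⟩, 0, fun h0 => hh ?_⟩, fun T hT => ?_⟩, ⟨h, hhS⟩, fun h0 => hh ?_⟩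
  · rw [show h = 0 from congrArg Subtype.val h0]
    simp
  · have h1 := hsimple (T.map S.subtype) (Submodule.map_subtype_le S T) (by
      rintro g _ ⟨t, ht, rfl⟩
      exact ⟨_, hT g t ht, rfl⟩)
    rcases h1 with h1 | h1
    · left
      exact Submodule.map_injective_of_injective S.injective_subtype
        (h1.trans (Submodule.map_bot _).symm)
    · right
      refine (Submodule.eq_top_iff'.2 fun s => ?_)
      have hs : (s : H) ∈ T.map S.subtype := by
        rw [h1]
        exact s.2
      obtain ⟨t, ht, hts⟩ := hs
      rwa [← show t = s from Subtype.ext hts]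
  · have := congrArg (S.subtype) h0
    simpa [map_sum, coe_restrict] using this

/-- The left regular `η`-representation `g δ_k = η(g, k) δ_{gk}`, on a Hilbert space with an
orthonormal basis indexed by `ι ≃ G`. -/
def leftRegular {ι : Type*} [Fintype ι] (e : G ≃ ι) (η : G → G → Circle)
    (hη : ∀ a b c, η b c * η a (b * c) = η a b * η (a * b) c) :
    UnitaryProjRep G η (EuclideanSpace ℂ ι) where
  toFun g := LinearIsometry.toLinearIsometryEquiv
    (⟨{ toFun := fun f => WithLp.toLp 2 fun i =>
          (η g (g⁻¹ * e.symm i) : ℂ) * f (e (g⁻¹ * e.symm i))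
        map_add' := fun f f' => by ext i; simp [mul_add]
        map_smul' := fun c f => by ext i; simp; ring },
      fun f => by
        rw [EuclideanSpace.norm_eq, EuclideanSpace.norm_eq]
        congr 1
        refine Fintype.sum_equiv ((e.symm.trans (Equiv.mulLeft g⁻¹)).trans e) _ _ fun i => ?_
        simp [Circle.norm_coe]⟩ : EuclideanSpace ℂ ι →ₗᵢ[ℂ] EuclideanSpace ℂ ι) rfl
  map_mul g₁ g₂ f := by
    ext i
    -- The third argument is the basis label that `g₁ g₂` moves to the label of `i`.
    have h := congrArg (fun z : Circle => (z : ℂ)) (hη g₁ g₂ (g₂⁻¹ * (g₁⁻¹ * e.symm i)))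
    simp only [Circle.coe_mul, mul_inv_cancel_left] at h
    have e1 : (g₁ * g₂)⁻¹ * e.symm i = g₂⁻¹ * (g₁⁻¹ * e.symm i) := by group
    simp only [LinearIsometry.coe_toLinearIsometryEquiv, LinearIsometry.coe_mk, LinearMap.coe_mk,
      AddHom.coe_mk, Equiv.symm_apply_apply, PiLp.smul_apply, smul_eq_mul, e1]
    linear_combination f (e (g₂⁻¹ * (g₁⁻¹ * e.symm i))) * h

theorem leftRegular_apply {ι : Type*} [Fintype ι] (e : G ≃ ι) (η : G → G → Circle)
    (hη : ∀ a b c, η b c * η a (b * c) = η a b * η (a * b) c) (g : G) (f : EuclideanSpace ℂ ι)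
    (i : ι) : (leftRegular e η hη).toFun g f i =
      (η g (g⁻¹ * e.symm i) : ℂ) * f (e (g⁻¹ * e.symm i)) := rfl

end

/-- The irreducible `η`-representations of a finite group separate the twisted group algebra. -/
theorem exists_irreducible_sum_ne_zero {G : Type*} [Group G] [Fintype G] (η : G → G → Circle)
    (hη : ∀ a b c, η b c * η a (b * c) = η a b * η (a * b) c) (hone : ∀ g, η g 1 = 1)
    (a : G → ℂ) (ha : a ≠ 0) :
    ∃ (H : Type v) (_ : NormedAddCommGroup H) (_ : InnerProductSpace ℂ H) (_ : CompleteSpace H)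
      (π : UnitaryProjRep G η H), π.IsIrreducible ∧ ∃ h, ∑ g, a g • π.toFun g h ≠ 0 := by
  classical
  -- The index type is lifted so that the resulting Hilbert space lies in the prescribed universe
  -- `v`.
  let e : G ≃ ULift.{v} (Fin (Fintype.card G)) := (Fintype.equivFin G).trans Equiv.ulift.symm
  -- Since `η(g, 1) = 1`, applying the operator to `δ_1` returns `a` itself as a vector.
  have hne : ∑ g, a g • (leftRegular e η hη).toFun g (EuclideanSpace.single (e 1) 1) ≠ 0 := by
    intro h0
    refine ha (funext fun k => ?_)
    have h1 := congrArg (fun f : EuclideanSpace ℂ _ => f (e k)) h0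
    simp only [WithLp.ofLp_sum, Finset.sum_apply, PiLp.smul_apply, leftRegular_apply,
      Equiv.symm_apply_apply, PiLp.single_apply, EmbeddingLike.apply_eq_iff_eq,
      inv_mul_eq_one, mul_ite, mul_one, mul_zero, smul_eq_mul, Finset.sum_ite_eq',
      Finset.mem_univ, if_true, inv_mul_cancel, hone, Circle.coe_one] at h1
    simpa using h1
  obtain ⟨S, hS, hirr, h⟩ := exists_irreducible_restrict _ a _ hne
  exact ⟨S, inferInstance, inferInstance, inferInstance, _, hirr, h⟩

end UnitaryProjRep

/-! ### Positivity and completeness criteria -/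

/-- A self-adjoint element `a` is positive as soon as `b⋆ a b` is never a nonzero negative
element. -/
theorem exists_eq_star_mul_self_of_conjugates {A : Type*} [NonUnitalCStarAlgebra A] {a : A}
    (ha : star a = a)
    (h : ∀ b c : A, star b * a * b = -(star c * c) → star b * a * b = 0) :
    ∃ b : A, a = star b * b := by
  let _ : PartialOrder A := CStarAlgebra.spectralOrder A
  let _ : StarOrderedRing A := CStarAlgebra.spectralOrderedRing A
  have hsa : IsSelfAdjoint a := ha
  have hneg : (0 : A) ≤ a⁻ := CFC.negPart_nonneg a
  have hstar : star a⁻ = a⁻ := (IsSelfAdjoint.of_nonneg hneg)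
  obtain ⟨c, hc⟩ := CStarAlgebra.nonneg_iff_eq_star_mul_self.1 hneg
  have hdec : a⁺ - a⁻ = a := CFC.posPart_sub_negPart a hsa
  have hzero : a⁻ * a⁺ = 0 := CFC.negPart_mul_posPart a
  -- The hypothesis is tested on `b = a⁻`. As `a⁻ a⁺ = 0`, the conjugate is minus the cube of `a⁻`,
  -- which is an inner square once `a⁻ = c⋆ c` is inserted in the middle.
  have h1 : a⁻ * a * a⁻ = -(a⁻ * a⁻ * a⁻) := by
    nth_rewrite 2 [← hdec]
    rw [mul_sub, hzero, zero_sub, neg_mul]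
  have h2 : a⁻ * a⁻ * a⁻ = star (c * a⁻) * (c * a⁻) := by
    nth_rewrite 2 [hc]
    rw [star_mul, hstar]
    simp only [mul_assoc]
  have h3 := h a⁻ (c * a⁻) (by rw [hstar, h1, h2])
  rw [hstar, h1, neg_eq_zero] at h3
  -- A self-adjoint element with zero cube is zero: the C⋆-identity is applied first to its square,
  -- then to the element.
  have h4 : a⁻ * a⁻ = 0 := by
    rw [← CStarRing.star_mul_self_eq_zero_iff, star_mul, hstar, ← mul_assoc, h3, zero_mul]
  have h5 : a⁻ = 0 := by
    rw [← CStarRing.star_mul_self_eq_zero_iff, hstar, h4]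
  rw [h5, sub_zero] at hdec
  exact CStarAlgebra.nonneg_iff_eq_star_mul_self.1 (hdec ▸ CFC.posPart_nonneg a)

/-- Transfers completeness to the norm of a new inner product: a Cauchy sequence for it is Cauchy
for the old norm, and continuity at `0` along the diagonal turns the old limit into a new one. -/
theorem exists_tendsto_of_norm_le_sqrt {E B : Type*} [NormedAddCommGroup E] [CompleteSpace E]
    [NormedAddCommGroup B] (q : E → E → B) (hle : ∀ x, ‖x‖ ≤ √‖q x x‖)
    (hq : Tendsto (fun x => q x x) (𝓝 0) (𝓝 0)) (u : ℕ → E)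
    (hu : ∀ ε > 0, ∃ N, ∀ m ≥ N, ∀ n ≥ N, √‖q (u m - u n) (u m - u n)‖ < ε) :
    ∃ x, Tendsto (fun n => √‖q (u n - x) (u n - x)‖) atTop (𝓝 0) := by
  have hcau : CauchySeq u := Metric.cauchySeq_iff.2 fun ε hε => by
    obtain ⟨N, hN⟩ := hu ε hε
    exact ⟨N, fun m hm n hn => by
      rw [dist_eq_norm]
      exact (hle _).trans_lt (hN m hm n hn)⟩
  obtain ⟨x, hx⟩ := cauchySeq_tendsto_of_complete hcau
  refine ⟨x, ?_⟩
  have h0 : Tendsto (fun n => u n - x) atTop (𝓝 0) := by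
    simpa using hx.sub_const x
  simpa using (hq.comp h0).norm.sqrt

theorem C0.norm_apply_le {X : Type*} [TopologicalSpace X] (b : C₀(X, ℂ)) (x : X) :
    ‖b x‖ ≤ ‖b‖ := by
  rw [← ZeroAtInftyContinuousMap.norm_toBCF_eq_norm]
  exact b.toBCF.norm_coe_le_norm x

theorem C0.norm_le_of_apply {X : Type*} [TopologicalSpace X] {b : C₀(X, ℂ)} {C : ℝ}
    (hC : 0 ≤ C) (h : ∀ x, ‖b x‖ ≤ C) : ‖b‖ ≤ C := by
  rw [← ZeroAtInftyContinuousMap.norm_toBCF_eq_norm]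
  exact (BoundedContinuousFunction.norm_le hC).2 h

/-! ### The twisted crossed product -/

namespace TwistedCrossedProduct

variable {W X : Type*} [Group W] [TopologicalSpace X] [MulAction W X] {γ : TwistingCocycle W X}
  [Fintype W] [ContinuousConstSMul W X]

theorem norm_coeff_one_le (f : TwistedCrossedProduct γ) : ‖f.coeff 1‖ ≤ ‖f‖ := by
  have h : regular f 1 1 = f.coeff 1 := by
    ext x
    rw [regular_apply]
    simp [γ.one_left]
  rw [← h]
  exact CStarMatrix.norm_entry_le_norm

/-- The norm of the crossed product is dominated by the supremum of the coefficients. -/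
theorem exists_norm_le_of_coeff_apply (γ : TwistingCocycle W X) :
    ∃ C : ℝ, 0 < C ∧ ∀ (f : TwistedCrossedProduct γ) (ε : ℝ), 0 ≤ ε →
      (∀ w x, ‖f.coeff w x‖ ≤ ε) → ‖f‖ ≤ C * ε := by
  -- The identity map is continuous from the entrywise supremum norm to the C⋆-norm, because both
  -- induce the same topology. Its operator norm supplies the constant, with `1` added only for
  -- strict positivity.
  let Φ : (W → W → C₀(X, ℂ)) →L[ℂ] CStarMatrix W W C₀(X, ℂ) :=
    ⟨{ toFun := fun M => CStarMatrix.ofMatrix M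
       map_add' := fun _ _ => rfl
       map_smul' := fun _ _ => rfl }, continuous_id⟩
  refine ⟨‖Φ‖ + 1, by positivity, fun f ε hε hf => ?_⟩
  have h1 : ‖regular f‖ ≤ ‖Φ‖ * ε := by
    refine (Φ.le_opNorm (fun u v => regular f u v)).trans ?_
    gcongr
    refine (pi_norm_le_iff_of_nonneg hε).2 fun u => (pi_norm_le_iff_of_nonneg hε).2 fun v => ?_
    refine C0.norm_le_of_apply hε fun x => ?_
    rw [regular_apply, norm_mul, Circle.norm_coe, one_mul]
    exact hf _ _
  rw [norm_def]
  linarith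

/-- Taking the coefficient at `1` is a positive map to `C₀(X)`: the twists cancel and leave a sum of
squares. -/
theorem coeff_one_star_mul_self_apply (c : TwistedCrossedProduct γ) (x : X) :
    (star c * c).coeff 1 x = ((∑ w : W, ‖c.coeff w⁻¹ (w⁻¹ • x)‖ ^ 2 : ℝ) : ℂ) := by
  rw [coeff_mul, C0_sum_apply]
  push_cast
  refine Finset.sum_congr rfl fun w _ => ?_
  simp only [mul_one, C0.unitaryMul_apply, ZeroAtInftyContinuousMap.coe_mul, Pi.mul_apply,
    coeff_star, C0.translate_apply, ContinuousMap.inv_apply, ZeroAtInftyContinuousMap.star_apply]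
  rw [mul_assoc, ← mul_assoc, ← Circle.coe_mul, mul_inv_cancel, Circle.coe_one, one_mul,
    ← Complex.conj_mul']
  rfl

end TwistedCrossedProduct

/-! ### Operators on the module -/

theorem AdjointableOp.sum_toCLM {A E ι : Type*} [NonUnitalCommCStarAlgebra A] [PartialOrder A]
    [StarOrderedRing A] [NormedAddCommGroup E] [NormedSpace ℂ E] [SMul A E] [CStarModule A E]
    (s : Finset ι) (T : ι → AdjointableOp A E) :
    (∑ i ∈ s, T i).toCLM = ∑ i ∈ s, (T i).toCLM :=
  map_sum (toCLMHom : AdjointableOp A E →ₙ+* (E →L[ℂ] E)) T s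

theorem AdjointableOp.norm_rankOne_le {A E : Type*} [NonUnitalCommCStarAlgebra A]
    [PartialOrder A] [StarOrderedRing A] [NormedAddCommGroup E] [NormedSpace ℂ E] [SMul A E]
    [CStarModule A E] (ξ η : E) : ‖rankOne A ξ η‖ ≤ ‖ξ‖ * ‖η‖ :=
  ContinuousLinearMap.opNorm_le_bound _ (by positivity) fun ζ => by
    change ‖inner A η ζ • ξ‖ ≤ _
    rw [mul_comm ‖ξ‖, mul_right_comm]
    exact (norm_smul_le _ _).trans
      (mul_le_mul_of_nonneg_right (CStarModule.norm_inner_le E) (norm_nonneg ξ))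

namespace TwistedModuleAction

/-! ### Pointwise calculus for the inner product and the twisted action -/

section Basic

variable {X E : Type*} [TopologicalSpace X] [NormedAddCommGroup E] [NormedSpace ℂ E]
  [SMul C₀(X, ℂ) E] [CStarModule C₀(X, ℂ) E]

theorem eq_of_inner_apply {ξ η : E}
    (h : ∀ (ζ : E) (x : X), inner C₀(X, ℂ) ζ ξ x = inner C₀(X, ℂ) ζ η x) : ξ = η :=
  AdjointableOp.eq_of_inner_left (A := C₀(X, ℂ)) fun ζ => by
    ext x
    exact h ζ x

theorem inner_self_apply (ξ : E) (x : X) :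
    inner C₀(X, ℂ) ξ ξ x = ((‖PreFibre.of E x ξ‖ ^ 2 : ℝ) : ℂ) := by
  rw [← PreFibre.inner_def, inner_self_eq_norm_sq_to_K]
  push_cast
  rfl

theorem star_inner_apply (ξ η : E) (x : X) :
    star (inner C₀(X, ℂ) ξ η x) = inner C₀(X, ℂ) η ξ x := by
  rw [← CStarModule.star_inner ξ η]
  rfl

theorem inner_sum_right_apply {ι : Type*} (s : Finset ι) (ζ : E) (ξ : ι → E) (x : X) :
    inner C₀(X, ℂ) ζ (∑ i ∈ s, ξ i) x = ∑ i ∈ s, inner C₀(X, ℂ) ζ (ξ i) x := by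
  rw [CStarModule.inner_sum_right, TwistedCrossedProduct.C0_sum_apply]

theorem inner_op_smul_right_apply (b : C₀(X, ℂ)) (ζ ξ : E) (x : X) :
    inner C₀(X, ℂ) ζ (b • ξ) x = b x * inner C₀(X, ℂ) ζ ξ x := by
  rw [CStarModule.inner_op_smul_right]
  rfl

theorem op_smul_add (b : C₀(X, ℂ)) (ξ η : E) : b • (ξ + η) = b • ξ + b • η :=
  AdjointableOp.eq_of_inner_left (A := C₀(X, ℂ)) fun ζ => by
    simp only [CStarModule.inner_op_smul_right, CStarModule.inner_add_right, mul_add]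

theorem add_op_smul (b c : C₀(X, ℂ)) (ξ : E) : (b + c) • ξ = b • ξ + c • ξ :=
  AdjointableOp.eq_of_inner_left (A := C₀(X, ℂ)) fun ζ => by
    simp only [CStarModule.inner_op_smul_right, CStarModule.inner_add_right, add_mul]

theorem op_smul_smul (z : ℂ) (b : C₀(X, ℂ)) (ξ : E) : b • (z • ξ) = z • (b • ξ) :=
  AdjointableOp.eq_of_inner_left (A := C₀(X, ℂ)) fun ζ => by
    simp only [CStarModule.inner_op_smul_right, CStarModule.inner_smul_right_complex,
      mul_smul_comm]

theorem smul_op_smul (z : ℂ) (b : C₀(X, ℂ)) (ξ : E) : (z • b) • ξ = z • (b • ξ) :=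
  AdjointableOp.eq_of_inner_left (A := C₀(X, ℂ)) fun ζ => by
    simp only [CStarModule.inner_op_smul_right, CStarModule.inner_smul_right_complex,
      smul_mul_assoc]

end Basic

variable {W X : Type*} [Group W] [TopologicalSpace X] [MulAction W X]
  [ContinuousConstSMul W X] {γ : TwistingCocycle W X} {E : Type*}
  [NormedAddCommGroup E] [NormedSpace ℂ E] [SMul C₀(X, ℂ) E] [CStarModule C₀(X, ℂ) E]
  (U : TwistedModuleAction γ E)

theorem inner_map_apply (w : W) (ξ η : E) (x : X) :
    inner C₀(X, ℂ) (U.U w ξ) (U.U w η) x = inner C₀(X, ℂ) ξ η (w⁻¹ • x) := by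
  rw [U.inner_map, C0.translate_apply]

theorem inner_symm_right_apply (w : W) (ζ ξ : E) (x : X) :
    inner C₀(X, ℂ) ζ ((U.U w).symm ξ) x = inner C₀(X, ℂ) (U.U w ζ) ξ (w • x) := by
  have h := U.inner_map_apply w ζ ((U.U w).symm ξ) (w • x)
  rw [ContinuousLinearEquiv.apply_symm_apply, inv_smul_smul] at h
  exact h.symm

theorem inner_mul_left_apply (v w : W) (ξ ζ : E) (x : X) :
    inner C₀(X, ℂ) (U.U v (U.U w ξ)) ζ x =
      (γ v w x : ℂ) * inner C₀(X, ℂ) (U.U (v * w) ξ) ζ x := by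
  rw [← star_inner_apply, U.inner_mul_apply, star_mul', star_inner_apply,
    Circle.coe_inv_eq_conj]
  congr 1
  exact star_star (γ v w x : ℂ)

/-- The normalisation of `γ` makes `U_1` idempotent, and an injective idempotent is the identity. -/
theorem U_one (ξ : E) : U.U 1 ξ = ξ := by
  refine (U.U 1).injective (eq_of_inner_apply (X := X) fun ζ x => ?_)
  rw [U.inner_mul_apply, γ.one_left]
  simp

theorem norm_map (w : W) (ξ : E) : ‖U.U w ξ‖ = ‖ξ‖ := by
  have hle : ∀ (v : W) (η : E), ‖U.U v η‖ ^ 2 ≤ ‖η‖ ^ 2 := fun v η => by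
    rw [CStarModule.norm_sq_eq C₀(X, ℂ), CStarModule.norm_sq_eq C₀(X, ℂ) (x := η)]
    refine C0.norm_le_of_apply (norm_nonneg _) fun x => ?_
    rw [U.inner_map_apply]
    exact C0.norm_apply_le _ _
  have hge : ‖ξ‖ ^ 2 ≤ ‖U.U w ξ‖ ^ 2 := by
    rw [CStarModule.norm_sq_eq C₀(X, ℂ), CStarModule.norm_sq_eq C₀(X, ℂ) (x := U.U w ξ)]
    refine C0.norm_le_of_apply (norm_nonneg _) fun x => ?_
    rw [← inv_smul_smul w x, ← U.inner_map_apply]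
    exact C0.norm_apply_le _ _
  exact le_antisymm ((pow_le_pow_iff_left₀ (norm_nonneg _) (norm_nonneg _) two_ne_zero).1
    (hle w ξ)) ((pow_le_pow_iff_left₀ (norm_nonneg _) (norm_nonneg _) two_ne_zero).1 hge)

theorem inner_mul_symm_apply (u w : W) (ζ ξ : E) (x : X) :
    inner C₀(X, ℂ) ζ (U.U u ((U.U w).symm ξ)) x =
      (γ (u * w⁻¹) w x : ℂ) * inner C₀(X, ℂ) ζ (U.U (u * w⁻¹) ξ) x := by
  have h := U.inner_mul_apply (u * w⁻¹) w ((U.U w).symm ξ) ζ x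
  rw [ContinuousLinearEquiv.apply_symm_apply, inv_mul_cancel_right] at h
  rw [h, ← mul_assoc, ← Circle.coe_mul, mul_inv_cancel, Circle.coe_one, one_mul]

@[simp]
theorem coeff_crossedInner (ξ η : E) (w : W) :
    (U.crossedInner ξ η).coeff w = inner C₀(X, ℂ) ξ (U.U w η) := rfl

/-- The coefficient at `1` is the original inner product, so nondegeneracy is inherited. Identities
in `E` can thus be checked inside the crossed product. -/
theorem eq_of_crossedInner {ξ η : E} (h : ∀ ζ, U.crossedInner ζ ξ = U.crossedInner ζ η) :
    ξ = η :=
  AdjointableOp.eq_of_inner_left (A := C₀(X, ℂ)) fun ζ => by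
    have h1 := congrArg (fun f => TwistedCrossedProduct.coeff f 1) (h ζ)
    simpa [U.U_one] using h1

/-- The phase `γ(v, w)` enters once linearly and once conjugated. Hence `U_v` conjugates rank-one
operators by a genuine, untwisted action of `W`. -/
theorem inner_mul_pair_apply (v w : W) (ξ η ζ θ : E) (x : X) :
    inner C₀(X, ℂ) (U.U v (U.U w η)) θ x * inner C₀(X, ℂ) ζ (U.U v (U.U w ξ)) x =
      inner C₀(X, ℂ) (U.U (v * w) η) θ x * inner C₀(X, ℂ) ζ (U.U (v * w) ξ) x := by
  rw [U.inner_mul_apply, U.inner_mul_left_apply, mul_mul_mul_comm, ← Circle.coe_mul,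
    mul_inv_cancel, Circle.coe_one, one_mul]

theorem fixedCompacts_ext {k l : U.fixedCompacts} (h : ∀ ξ, U.leftSMul k ξ = U.leftSMul l ξ) :
    k = l :=
  Subtype.ext (AdjointableOp.toCLM_injective (ContinuousLinearMap.ext h))

theorem leftSMul_mul (k l : U.fixedCompacts) (ξ : E) :
    U.leftSMul (k * l) ξ = U.leftSMul k (U.leftSMul l ξ) := rfl

theorem inner_leftSMul (k : U.fixedCompacts) (ξ η : E) :
    inner C₀(X, ℂ) (U.leftSMul k ξ) η = inner C₀(X, ℂ) ξ (U.leftSMul (star k) η) :=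
  (k : AdjointableOp C₀(X, ℂ) E).inner_toCLM ξ η

theorem eq_zero_of_crossedInner_self {ξ : E} (h : (U.crossedInner ξ ξ).coeff 1 = 0) : ξ = 0 := by
  rw [coeff_crossedInner, U.U_one] at h
  exact CStarModule.inner_self.1 h

theorem crossedInner_leftSMul (k : U.fixedCompacts) (ξ η : E) :
    U.crossedInner (U.leftSMul k ξ) η = U.crossedInner ξ (U.leftSMul (star k) η) := by
  ext w x
  rw [coeff_crossedInner, coeff_crossedInner, U.inner_leftSMul]
  congr 2
  exact ((star k).2.2 w η).symm

variable [Fintype W]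

/-! ### The right module structure -/

/-- The operator `U_u U_w⁻¹` is `U_{uw⁻¹}` multiplied by `γ(uw⁻¹, w)`, and this is the phase in the
product of the crossed product after the substitution `v = uw⁻¹`. -/
theorem crossedInner_rightSMul (ξ η : E) (f : TwistedCrossedProduct γ) :
    U.crossedInner ξ (U.rightSMul η f) = U.crossedInner ξ η * f := by
  ext u x
  rw [TwistedCrossedProduct.coeff_mul, TwistedCrossedProduct.C0_sum_apply, coeff_crossedInner,
    rightSMul, map_sum, inner_sum_right_apply]
  refine (Fintype.sum_equiv ((Equiv.inv W).trans (Equiv.mulRight u)) _ _ fun v => ?_).symm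
  have e1 : u * (v⁻¹ * u)⁻¹ = v := by group
  simp only [Equiv.trans_apply, Equiv.inv_apply, Equiv.coe_mulRight, inner_mul_symm_apply, e1,
    U.map_smul, inner_op_smul_right_apply, C0.translate_apply, C0.unitaryMul_apply,
    ZeroAtInftyContinuousMap.coe_mul, Pi.mul_apply, coeff_crossedInner]
  ring

theorem star_crossedInner (ξ η : E) : star (U.crossedInner ξ η) = U.crossedInner η ξ := by
  ext u x
  rw [TwistedCrossedProduct.coeff_star, coeff_crossedInner, coeff_crossedInner,
    C0.unitaryMul_apply, C0.translate_apply, ZeroAtInftyContinuousMap.star_apply,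
    star_inner_apply, ← U.inner_map_apply, U.inner_mul_left_apply, mul_inv_cancel, U.U_one,
    ContinuousMap.inv_apply, ← mul_assoc, ← Circle.coe_mul, inv_mul_cancel, Circle.coe_one,
    one_mul]

theorem crossedInner_rightSMul_left (ξ η : E) (f : TwistedCrossedProduct γ) :
    U.crossedInner (U.rightSMul ξ f) η = star f * U.crossedInner ξ η := by
  rw [← U.star_crossedInner, U.crossedInner_rightSMul, star_mul, U.star_crossedInner]

/-- Pairing with an arbitrary vector reduces this to associativity in the crossed product. -/
theorem rightSMul_mul (ξ : E) (f g : TwistedCrossedProduct γ) :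
    U.rightSMul ξ (f * g) = U.rightSMul (U.rightSMul ξ f) g :=
  U.eq_of_crossedInner fun ζ => by
    rw [U.crossedInner_rightSMul, U.crossedInner_rightSMul, U.crossedInner_rightSMul, mul_assoc]

theorem rightSMul_add_left (ξ η : E) (f : TwistedCrossedProduct γ) :
    U.rightSMul (ξ + η) f = U.rightSMul ξ f + U.rightSMul η f := by
  simp only [rightSMul, op_smul_add, map_add, Finset.sum_add_distrib]

theorem rightSMul_smul_left (z : ℂ) (ξ : E) (f : TwistedCrossedProduct γ) :
    U.rightSMul (z • ξ) f = z • U.rightSMul ξ f := by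
  simp only [rightSMul, op_smul_smul, _root_.map_smul, Finset.smul_sum]

theorem crossedInner_add_right (ξ η ζ : E) :
    U.crossedInner ξ (η + ζ) = U.crossedInner ξ η + U.crossedInner ξ ζ := by
  ext w x
  simp [CStarModule.inner_add_right]

theorem crossedInner_zero : U.crossedInner 0 0 = 0 := by
  ext w x
  simp

theorem norm_le_sqrt_crossedInner (ξ : E) : ‖ξ‖ ≤ √‖U.crossedInner ξ ξ‖ := by
  refine Real.le_sqrt_of_sq_le ?_
  have h := TwistedCrossedProduct.norm_coeff_one_le (U.crossedInner ξ ξ)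
  rwa [coeff_crossedInner, U.U_one, ← CStarModule.norm_sq_eq] at h

theorem tendsto_crossedInner_self :
    Tendsto (fun ξ : E => U.crossedInner ξ ξ) (𝓝 0) (𝓝 0) := by
  obtain ⟨C, hC, h⟩ := TwistedCrossedProduct.exists_norm_le_of_coeff_apply γ
  have h0 : Tendsto (fun ξ : E => C * ‖ξ‖ ^ 2) (𝓝 0) (𝓝 0) := by
    have : Continuous fun ξ : E => C * ‖ξ‖ ^ 2 := by fun_prop
    simpa using this.tendsto 0
  refine squeeze_zero_norm (fun ξ => h _ _ (by positivity) fun w x => ?_) h0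
  refine (C0.norm_apply_le _ x).trans ((CStarModule.norm_inner_le E).trans ?_)
  rw [U.norm_map, sq]

/-- Conjugation by `b` replaces `ξ` by `ξ b`. If the result were `-(c⋆ c)`, the coefficients at `1`
would be a pointwise nonnegative function equal to a nonpositive one, which forces `ξ b = 0`. -/
theorem crossedInner_self_nonneg (ξ : E) :
    ∃ b : TwistedCrossedProduct γ, U.crossedInner ξ ξ = star b * b := by
  refine exists_eq_star_mul_self_of_conjugates (U.star_crossedInner ξ ξ) fun b c h => ?_
  rw [← U.crossedInner_rightSMul_left, ← U.crossedInner_rightSMul] at h ⊢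
  have h0 : U.rightSMul ξ b = 0 := by
    refine U.eq_zero_of_crossedInner_self ?_
    ext x
    have h1 := congrArg (fun f => TwistedCrossedProduct.coeff f 1 x) h
    change _ = -((star c * c).coeff 1 x) at h1
    rw [TwistedCrossedProduct.coeff_one_star_mul_self_apply, coeff_crossedInner, U.U_one,
      inner_self_apply, ← Complex.ofReal_neg, Complex.ofReal_inj] at h1
    have h2 : 0 ≤ ∑ w : W, ‖c.coeff w⁻¹ (w⁻¹ • x)‖ ^ 2 := by positivity
    have h3 := sq_nonneg ‖PreFibre.of E x (U.rightSMul ξ b)‖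
    rw [coeff_crossedInner, U.U_one, inner_self_apply, le_antisymm (by linarith) h3]
    rfl
  rw [h0, crossedInner_zero]

theorem isRightHilbertModule [CompleteSpace E] :
    IsRightHilbertModule U.rightSMul U.crossedInner where
  add_smul := U.rightSMul_add_left
  smul_add ξ f g := by
    simp only [rightSMul, TwistedCrossedProduct.coeff_add, add_op_smul, map_add,
      Finset.sum_add_distrib]
  smul_mul := U.rightSMul_mul
  scalar_smul := U.rightSMul_smul_left
  smul_scalar z ξ f := by
    simp only [rightSMul, TwistedCrossedProduct.coeff_smul, smul_op_smul, _root_.map_smul,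
      Finset.smul_sum]
  inner_add := U.crossedInner_add_right
  inner_scalar z ξ η := by
    ext w x
    simp [CStarModule.inner_smul_right_complex]
  inner_smul := U.crossedInner_rightSMul
  star_inner := U.star_crossedInner
  inner_self_nonneg := U.crossedInner_self_nonneg
  inner_self_eq_zero ξ h := U.eq_zero_of_crossedInner_self (by rw [h]; rfl)
  complete := exists_tendsto_of_norm_le_sqrt _ U.norm_le_sqrt_crossedInner
    U.tendsto_crossedInner_self

/-! ### The left inner product -/

/-- The operator `∑ w, |U_w ξ⟩⟨U_w η|`. -/
def orbitRankOne (ξ η : E) : AdjointableOp C₀(X, ℂ) E :=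
  ∑ w : W, AdjointableOp.rankOne C₀(X, ℂ) (U.U w ξ) (U.U w η)

theorem inner_orbitRankOne_apply (ξ η ζ θ : E) (x : X) :
    inner C₀(X, ℂ) ζ ((U.orbitRankOne ξ η).toCLM θ) x =
      ∑ w : W, inner C₀(X, ℂ) (U.U w η) θ x * inner C₀(X, ℂ) ζ (U.U w ξ) x := by
  rw [orbitRankOne, AdjointableOp.sum_toCLM, _root_.sum_apply,
    inner_sum_right_apply]
  refine Finset.sum_congr rfl fun w _ => ?_
  rw [AdjointableOp.rankOne_toCLM, inner_op_smul_right_apply]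

/-- Conjugation by `U_v` permutes the summands by left translation, as the phases cancel. -/
theorem orbitRankOne_comm (ξ η : E) (v : W) (θ : E) :
    U.U v ((U.orbitRankOne ξ η).toCLM θ) = (U.orbitRankOne ξ η).toCLM (U.U v θ) := by
  refine eq_of_inner_apply (X := X) fun ζ x => ?_
  obtain ⟨ζ, rfl⟩ := (U.U v).surjective ζ
  rw [U.inner_map_apply, U.inner_orbitRankOne_apply, U.inner_orbitRankOne_apply]
  refine Fintype.sum_equiv (Equiv.mulLeft v) _ _ fun w => ?_
  rw [Equiv.coe_mulLeft, ← U.inner_mul_pair_apply, U.inner_map_apply, U.inner_map_apply]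

/-- The inner product with values in the fixed-point algebra. -/
def leftInner (ξ η : E) : U.fixedCompacts :=
  ⟨U.orbitRankOne ξ η, sum_mem fun _ _ => NonUnitalStarSubalgebra.le_topologicalClosure _
    (Submodule.subset_span ⟨_, _, rfl⟩), U.orbitRankOne_comm ξ η⟩

@[simp]
theorem coe_leftInner (ξ η : E) :
    (U.leftInner ξ η : AdjointableOp C₀(X, ℂ) E) = U.orbitRankOne ξ η := rfl

/-- Under `w ↦ w⁻¹` the operators `U_{w⁻¹}` and `U_w⁻¹` differ by a phase, which occurs with
opposite signs in the two factors. This compatibility lets most axioms for the left inner product be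
deduced from the right module structure. -/
theorem leftSMul_leftInner (ξ η θ : E) :
    U.leftSMul (U.leftInner ξ η) θ = U.rightSMul ξ (U.crossedInner η θ) := by
  refine eq_of_inner_apply (X := X) fun ζ x => ?_
  rw [leftSMul, coe_leftInner, U.inner_orbitRankOne_apply, rightSMul, inner_sum_right_apply]
  refine Fintype.sum_equiv (Equiv.inv W) _ _ fun w => ?_
  rw [Equiv.inv_apply, inner_symm_right_apply, inner_op_smul_right_apply, coeff_crossedInner,
    ← U.inner_map_apply w, ← U.inner_map_apply w, U.inner_mul_apply, U.inner_mul_left_apply,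
    mul_inv_cancel, U.U_one, U.U_one, mul_mul_mul_comm, ← Circle.coe_mul, inv_mul_cancel,
    Circle.coe_one, one_mul]

theorem leftSMul_rightSMul (k : U.fixedCompacts) (ξ : E) (f : TwistedCrossedProduct γ) :
    U.leftSMul k (U.rightSMul ξ f) = U.rightSMul (U.leftSMul k ξ) f := by
  rw [rightSMul, rightSMul, leftSMul, map_sum]
  refine Finset.sum_congr rfl fun w _ => (U.U w).injective ?_
  rw [k.2.2 w, ContinuousLinearEquiv.apply_symm_apply, ContinuousLinearEquiv.apply_symm_apply,
    AdjointableOp.toCLM_op_smul]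
  rfl

theorem leftInner_leftSMul (k : U.fixedCompacts) (ξ η : E) :
    U.leftInner (U.leftSMul k ξ) η = k * U.leftInner ξ η :=
  U.fixedCompacts_ext fun θ => by
    rw [U.leftSMul_mul, U.leftSMul_leftInner, U.leftSMul_leftInner, U.leftSMul_rightSMul]

theorem star_leftInner (ξ η : E) : star (U.leftInner ξ η) = U.leftInner η ξ :=
  Subtype.ext <| by
    change star (∑ w : W, AdjointableOp.rankOne C₀(X, ℂ) (U.U w ξ) (U.U w η)) = _
    rw [star_sum]
    rfl

theorem inner_leftInner_self_apply (ξ ζ : E) (x : X) :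
    inner C₀(X, ℂ) ζ (U.leftSMul (U.leftInner ξ ξ) ζ) x =
      ((∑ w : W, ‖inner C₀(X, ℂ) (U.U w ξ) ζ x‖ ^ 2 : ℝ) : ℂ) := by
  rw [leftSMul, coe_leftInner, U.inner_orbitRankOne_apply]
  push_cast
  refine Finset.sum_congr rfl fun w _ => ?_
  rw [← star_inner_apply (U.U w ξ) ζ, ← Complex.mul_conj']
  rfl

/-- Only the term `w = 1` of the sum of squares is kept. -/
theorem norm_inner_self_apply_sq_le (ξ : E) (x : X) :
    ‖inner C₀(X, ℂ) ξ ξ x‖ ^ 2 ≤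
      ‖inner C₀(X, ℂ) ξ (U.leftSMul (U.leftInner ξ ξ) ξ) x‖ := by
  have h : ‖inner C₀(X, ℂ) (U.U 1 ξ) ξ x‖ ^ 2 ≤
      ∑ w : W, ‖inner C₀(X, ℂ) (U.U w ξ) ξ x‖ ^ 2 :=
    Finset.single_le_sum (f := fun w : W => ‖inner C₀(X, ℂ) (U.U w ξ) ξ x‖ ^ 2)
      (fun w _ => by positivity) (Finset.mem_univ 1)
  rw [U.inner_leftInner_self_apply, Complex.norm_real, Real.norm_eq_abs]
  rw [U.U_one] at h
  exact h.trans (le_abs_self _)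

theorem eq_zero_of_inner_leftInner_self {ξ : E}
    (h : ∀ x : X, inner C₀(X, ℂ) ξ (U.leftSMul (U.leftInner ξ ξ) ξ) x = 0) : ξ = 0 := by
  refine CStarModule.inner_self (A := C₀(X, ℂ)).1 ?_
  ext x
  have h1 := U.norm_inner_self_apply_sq_le ξ x
  rw [h, norm_zero] at h1
  exact norm_eq_zero.1 (pow_eq_zero_iff two_ne_zero |>.1 (le_antisymm h1 (by positivity)))

/-- With `k` the left inner square of `ξ`, one has `‖ξ‖⁴ ≤ ‖⟨ξ | k ξ⟩‖ ≤ ‖k‖ ‖ξ‖²`; then `‖ξ‖²` is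
cancelled. -/
theorem norm_le_sqrt_leftInner (ξ : E) : ‖ξ‖ ≤ √‖U.leftInner ξ ξ‖ := by
  refine Real.le_sqrt_of_sq_le ?_
  rcases eq_or_ne ξ 0 with rfl | hξ
  · simp
  have h1 : ‖ξ‖ ^ 2 * ‖ξ‖ ^ 2 ≤ ‖U.leftInner ξ ξ‖ * ‖ξ‖ ^ 2 := by
    rw [← sq, ← Real.le_sqrt (by positivity) (by positivity), CStarModule.norm_sq_eq C₀(X, ℂ)]
    refine C0.norm_le_of_apply (Real.sqrt_nonneg _) fun x => ?_
    refine Real.le_sqrt_of_sq_le ((U.norm_inner_self_apply_sq_le ξ x).trans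
      ((C0.norm_apply_le _ _).trans ((CStarModule.norm_inner_le E).trans ?_)))
    rw [← CStarModule.norm_sq_eq]
    have h2 : ‖U.leftSMul (U.leftInner ξ ξ) ξ‖ ≤ ‖U.leftInner ξ ξ‖ * ‖ξ‖ :=
      (U.orbitRankOne ξ ξ).toCLM.le_opNorm ξ
    nlinarith [norm_nonneg ξ]
  exact le_of_mul_le_mul_right h1 (by positivity)

theorem tendsto_leftInner_self :
    Tendsto (fun ξ : E => U.leftInner ξ ξ) (𝓝 0) (𝓝 0) := by
  have h0 : Tendsto (fun ξ : E => ∑ _w : W, ‖ξ‖ * ‖ξ‖) (𝓝 0) (𝓝 0) := by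
    have : Continuous fun ξ : E => ∑ _w : W, ‖ξ‖ * ‖ξ‖ := by fun_prop
    simpa using this.tendsto 0
  refine squeeze_zero_norm (fun ξ => ?_) h0
  change ‖U.orbitRankOne ξ ξ‖ ≤ _
  refine (norm_sum_le _ _).trans (Finset.sum_le_sum fun w _ => ?_)
  refine (AdjointableOp.norm_rankOne_le _ _).trans ?_
  rw [U.norm_map]

/-- Conjugation by `b` replaces `ξ` by `η = b⋆ ξ`. If the result were `-(c⋆ c)`, its quadratic form
at `η` would be both a sum of squares and nonpositive, which forces `η = 0`. -/
theorem leftInner_self_nonneg [CompleteSpace E] (ξ : E) :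
    ∃ k : U.fixedCompacts, U.leftInner ξ ξ = star k * k := by
  refine exists_eq_star_mul_self_of_conjugates (U.star_leftInner ξ ξ) fun b c h => ?_
  have h1 : star b * U.leftInner ξ ξ * b =
      U.leftInner (U.leftSMul (star b) ξ) (U.leftSMul (star b) ξ) := by
    rw [U.leftInner_leftSMul, mul_assoc]
    congr 1
    rw [← U.star_leftInner (U.leftSMul (star b) ξ), U.leftInner_leftSMul,
      star_mul, star_star, U.star_leftInner]
  rw [h1] at h ⊢
  generalize U.leftSMul (star b) ξ = η at h ⊢
  have h0 : η = 0 := by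
    refine U.eq_zero_of_inner_leftInner_self fun x => ?_
    have h2 : inner C₀(X, ℂ) η (U.leftSMul (U.leftInner η η) η) x =
        -inner C₀(X, ℂ) (U.leftSMul c η) (U.leftSMul c η) x := by
      rw [h, U.inner_leftSMul, ← U.leftSMul_mul]
      change inner C₀(X, ℂ) η (-(U.leftSMul (star c * c) η)) x = _
      rw [CStarModule.inner_neg_right]
      rfl
    rw [U.inner_leftInner_self_apply, inner_self_apply, ← Complex.ofReal_neg,
      Complex.ofReal_inj] at h2
    have h3 : 0 ≤ ∑ w : W, ‖inner C₀(X, ℂ) (U.U w η) η x‖ ^ 2 := by positivity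
    have h4 := sq_nonneg ‖PreFibre.of E x (U.leftSMul c η)‖
    rw [U.inner_leftInner_self_apply, le_antisymm (by linarith) h3, Complex.ofReal_zero]
  refine U.fixedCompacts_ext fun θ => ?_
  rw [U.leftSMul_leftInner, h0]
  refine U.eq_of_crossedInner fun ζ => ?_
  rw [U.crossedInner_rightSMul]
  have h5 : ∀ ζ, U.crossedInner ζ (0 : E) = 0 := fun ζ => by
    ext w x
    simp
  rw [h5, zero_mul]
  exact (h5 ζ).symm

theorem isLeftHilbertModule [CompleteSpace E] :
    IsLeftHilbertModule U.leftSMul U.leftInner where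
  smul_add k ξ η := map_add _ _ _
  add_smul k l ξ := rfl
  mul_smul := U.leftSMul_mul
  smul_scalar z k ξ := _root_.map_smul _ _ _
  scalar_smul z k ξ := rfl
  inner_add ξ η ζ := U.fixedCompacts_ext fun θ => by
    change _ = U.leftSMul (U.leftInner ξ ζ) θ + U.leftSMul (U.leftInner η ζ) θ
    simp only [U.leftSMul_leftInner, U.rightSMul_add_left]
  inner_scalar z ξ η := U.fixedCompacts_ext fun θ => by
    change _ = z • U.leftSMul (U.leftInner ξ η) θ
    simp only [U.leftSMul_leftInner, U.rightSMul_smul_left]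
  inner_smul := U.leftInner_leftSMul
  star_inner := U.star_leftInner
  inner_self_nonneg := U.leftInner_self_nonneg
  inner_self_eq_zero ξ h := by
    refine U.eq_zero_of_inner_leftInner_self fun x => ?_
    rw [h]
    change inner C₀(X, ℂ) ξ (0 : E) x = 0
    simp
  complete := exists_tendsto_of_norm_le_sqrt _ U.norm_le_sqrt_leftInner
    U.tendsto_leftInner_self

/-! ### Fullness of the left inner product -/

/-- Since `U_w |ξ⟩⟨η| U_w⁻¹ = |U_w ξ⟩⟨U_w η|`, summing the conjugates of a finite-rank operator over
`W` lands in the span of the left inner products. -/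
theorem sum_conj_mem_span_leftInner {S : AdjointableOp C₀(X, ℂ) E}
    (hS : S ∈ AdjointableOp.finiteRank C₀(X, ℂ) E) :
    ∃ a ∈ Submodule.span ℂ {a : U.fixedCompacts | ∃ ξ η : E, a = U.leftInner ξ η},
      ∀ θ, U.leftSMul a θ = ∑ w : W, U.U w (S.toCLM ((U.U w).symm θ)) := by
  change S ∈ Submodule.span ℂ _ at hS
  induction hS using Submodule.span_induction with
  | mem S hS =>
    obtain ⟨ξ, η, rfl⟩ := hS
    refine ⟨U.leftInner ξ η, Submodule.subset_span ⟨ξ, η, rfl⟩, fun θ => ?_⟩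
    rw [leftSMul, coe_leftInner, orbitRankOne, AdjointableOp.sum_toCLM, _root_.sum_apply]
    refine Finset.sum_congr rfl fun w _ => ?_
    rw [AdjointableOp.rankOne_toCLM, AdjointableOp.rankOne_toCLM, U.map_smul, ← U.inner_map,
      ContinuousLinearEquiv.apply_symm_apply]
  | zero => exact ⟨0, Submodule.zero_mem _, fun θ => by simp [leftSMul]⟩
  | add S T _ _ hS hT =>
    obtain ⟨a, ha, ha'⟩ := hS
    obtain ⟨b, hb, hb'⟩ := hT
    refine ⟨a + b, Submodule.add_mem _ ha hb, fun θ => ?_⟩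
    change U.leftSMul a θ + U.leftSMul b θ = _
    simp [ha', hb', Finset.sum_add_distrib]
  | smul c S _ hS =>
    obtain ⟨a, ha, ha'⟩ := hS
    refine ⟨c • a, Submodule.smul_mem _ c ha, fun θ => ?_⟩
    change c • U.leftSMul a θ = _
    simp [ha', Finset.smul_sum]

/-- Approximate a fixed compact operator by a finite-rank one and average over `W`. The fixed
operator is its own average, and averaging over isometries does not increase the distance. -/
theorem dense_span_leftInner :
    Dense (Submodule.span ℂ {a : U.fixedCompacts | ∃ ξ η : E, a = U.leftInner ξ η} :
      Set U.fixedCompacts) := by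
  intro k
  rw [Metric.mem_closure_iff]
  intro ε hε
  have hk : (k : AdjointableOp C₀(X, ℂ) E) ∈
      closure (AdjointableOp.finiteRank C₀(X, ℂ) E : Set (AdjointableOp C₀(X, ℂ) E)) := k.2.1
  obtain ⟨S, hS, hdist⟩ := Metric.mem_closure_iff.1 hk ε hε
  obtain ⟨a, ha, ha'⟩ := U.sum_conj_mem_span_leftInner hS
  have hcard : (Fintype.card W : ℂ) ≠ 0 := Nat.cast_ne_zero.2 Fintype.card_ne_zero
  refine ⟨(Fintype.card W : ℂ)⁻¹ • a, Submodule.smul_mem _ _ ha, lt_of_le_of_lt ?_ hdist⟩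
  rw [dist_eq_norm, dist_eq_norm]
  change ‖((k : AdjointableOp C₀(X, ℂ) E) - (Fintype.card W : ℂ)⁻¹ • a.1).toCLM‖ ≤ _
  refine ContinuousLinearMap.opNorm_le_bound _ (norm_nonneg _) fun θ => ?_
  have h1 : ((k : AdjointableOp C₀(X, ℂ) E) - (Fintype.card W : ℂ)⁻¹ • a.1).toCLM θ =
      (Fintype.card W : ℂ)⁻¹ • ∑ w : W, U.U w
        (((k : AdjointableOp C₀(X, ℂ) E) - S).toCLM ((U.U w).symm θ)) := by
    have h2 : ∀ w : W, U.U w (((k : AdjointableOp C₀(X, ℂ) E) - S).toCLM ((U.U w).symm θ)) =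
        U.leftSMul k θ - U.U w (S.toCLM ((U.U w).symm θ)) := fun w => by
      change U.U w (k.1.toCLM _ - S.toCLM _) = _
      rw [map_sub, k.2.2 w, ContinuousLinearEquiv.apply_symm_apply]
      rfl
    simp only [h2, Finset.sum_sub_distrib, ← ha']
    rw [Finset.sum_const, Finset.card_univ, smul_sub, ← Nat.cast_smul_eq_nsmul ℂ,
      inv_smul_smul₀ hcard]
    rfl
  rw [h1, norm_smul, norm_inv, RCLike.norm_natCast, inv_mul_le_iff₀
    (by exact_mod_cast Fintype.card_pos)]
  refine (norm_sum_le _ _).trans ?_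
  rw [← nsmul_eq_mul, ← Finset.card_univ]
  refine Finset.sum_le_card_nsmul _ _ _ fun w _ => ?_
  rw [U.norm_map]
  refine (ContinuousLinearMap.le_opNorm _ _).trans (le_of_eq ?_)
  rw [← U.norm_map w ((U.U w).symm θ), ContinuousLinearEquiv.apply_symm_apply]
  rfl

/-- All the axioms of a Morita equivalence hold automatically, except for the fullness of the
right inner product. -/
theorem isMoritaEquivalence_iff_dense [CompleteSpace E] :
    IsMoritaEquivalence (A := U.fixedCompacts) (B := TwistedCrossedProduct γ)
        U.leftSMul U.rightSMul U.crossedInner ↔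
      Dense (Submodule.span ℂ {b : TwistedCrossedProduct γ | ∃ ξ η : E, b = U.crossedInner ξ η} :
        Set (TwistedCrossedProduct γ)) := by
  refine ⟨fun ⟨_, h⟩ => h.right_full, fun h => ⟨U.leftInner, ?_⟩⟩
  exact
    { left := U.isLeftHilbertModule
      right := U.isRightHilbertModule
      smul_comm := U.leftSMul_rightSMul
      left_full := U.dense_span_leftInner
      right_full := h
      rinner_lsmul := U.crossedInner_leftSMul
      linner_rsmul := fun f ξ η => U.fixedCompacts_ext fun θ => by
        rw [U.leftSMul_leftInner, U.leftSMul_leftInner, ← U.rightSMul_mul,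
          U.crossedInner_rightSMul_left, star_star]
      linner_smul := U.leftSMul_leftInner }

end TwistedModuleAction

/-! ### Bump functions, convex approximation and finite-dimensional duality -/

/-- A compactly supported continuous function, as a complex function vanishing at infinity. -/
def C0.ofCompactSupport {X : Type*} [TopologicalSpace X] (f : C(X, ℝ))
    (hf : HasCompactSupport f) : C₀(X, ℂ) where
  toFun x := (f x : ℂ)
  continuous_toFun := by fun_prop
  zero_at_infty' :=
    (hf.comp_left (g := fun r : ℝ => (r : ℂ)) Complex.ofReal_zero).is_zero_at_infty

@[simp]
theorem C0.ofCompactSupport_apply {X : Type*} [TopologicalSpace X] (f : C(X, ℝ))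
    (hf : HasCompactSupport f) (x : X) : C0.ofCompactSupport f hf x = (f x : ℂ) := rfl

theorem C0.exists_eq_one_eq_zero {X : Type*} [TopologicalSpace X] [T2Space X]
    [LocallyCompactSpace X] {x : X} {s : Set X} (hs : s.Finite) (hx : x ∉ s) :
    ∃ b : C₀(X, ℂ), b x = 1 ∧ ∀ y ∈ s, b y = 0 := by
  obtain ⟨f, h1, h0, hf, -⟩ := exists_continuous_one_zero_of_isCompact
    (isCompact_singleton (x := x)) hs.isClosed (Set.disjoint_singleton_left.2 hx)
  exact ⟨C0.ofCompactSupport f hf, by simp [h1 rfl], fun y hy => by simp [h0 hy]⟩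

theorem C0.isCompact_le_norm {X : Type*} [TopologicalSpace X] (b : C₀(X, ℂ)) {ε : ℝ}
    (hε : 0 < ε) : IsCompact {x | ε ≤ ‖b x‖} := by
  have h : ∀ᶠ x in cocompact X, ‖b x‖ < ε :=
    (tendsto_zero_iff_norm_tendsto_zero.1 b.zero_at_infty').eventually_lt_const hε
  obtain ⟨K, hK, hsub⟩ := mem_cocompact.1 h
  refine hK.of_isClosed_subset (isClosed_le continuous_const (by fun_prop)) fun x hx => ?_
  by_contra hxK
  have h1 : ‖b x‖ < ε := hsub hxK
  exact absurd h1 (not_lt.2 hx)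

/-- Approximation of `a` by a convex combination of `0` and of approximations of `a`. -/
theorem norm_sub_sum_mul_le {ι : Type*} [Fintype ι] (a : ℂ) (b : ι → ℂ) (p : ι → ℝ) {ε : ℝ}
    (hp : ∀ i, 0 ≤ p i) (hsum : ∑ i, p i ≤ 1) (hb : ∀ i, p i ≠ 0 → ‖a - b i‖ ≤ ε)
    (ha : ∑ i, p i = 1 ∨ ‖a‖ ≤ ε) : ‖a - ∑ i, (p i : ℂ) * b i‖ ≤ ε := by
  have h1 : a - ∑ i, (p i : ℂ) * b i =
      ∑ i, (p i : ℂ) * (a - b i) + ((1 - ∑ i, p i : ℝ) : ℂ) * a := by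
    push_cast
    simp only [mul_sub, Finset.sum_sub_distrib, ← Finset.sum_mul]
    ring
  have h2 : ∀ i, ‖(p i : ℂ) * (a - b i)‖ ≤ p i * ε := fun i => by
    rw [norm_mul, Complex.norm_real, Real.norm_eq_abs, abs_of_nonneg (hp i)]
    rcases eq_or_ne (p i) 0 with h | h
    · simp [h]
    · exact mul_le_mul_of_nonneg_left (hb i h) (hp i)
  have h3 : ‖((1 - ∑ i, p i : ℝ) : ℂ) * a‖ ≤ (1 - ∑ i, p i) * ε := by
    rw [norm_mul, Complex.norm_real, Real.norm_eq_abs, abs_of_nonneg (by linarith)]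
    rcases ha with h | h
    · simp [h]
    · exact mul_le_mul_of_nonneg_left h (by linarith)
  rw [h1]
  refine (norm_add_le _ _).trans ((add_le_add ((norm_sum_le _ _).trans
    (Finset.sum_le_sum fun i _ => h2 i)) h3).trans (le_of_eq ?_))
  rw [← Finset.sum_mul]
  ring

theorem Submodule.eq_top_of_forall_sum_mul_eq_zero {ι : Type*} [Fintype ι]
    (S : Submodule ℂ (ι → ℂ))
    (h : ∀ c : ι → ℂ, (∀ s ∈ S, ∑ i, s i * c i = 0) → c = 0) : S = ⊤ := by
  classical
  by_contra hS
  obtain ⟨f, hf, hle⟩ := Submodule.exists_le_ker_of_lt_top S (lt_top_iff_ne_top.2 hS)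
  -- A nonzero functional vanishing on a proper subspace is a coordinate pairing, bilinear with no
  -- conjugation, as the hypothesis requires.
  have hfs : ∀ s : ι → ℂ, f s = ∑ i, s i * f (Pi.single i 1) := fun s => by
    conv_lhs => rw [← Finset.univ_sum_single s]
    rw [map_sum]
    refine Finset.sum_congr rfl fun i _ => ?_
    rw [← smul_eq_mul, ← map_smul, ← Pi.single_smul, smul_eq_mul, mul_one]
  have hc := h (fun i => f (Pi.single i 1)) fun s hs => by
    rw [← hfs]
    exact hle hs
  refine hf (LinearMap.ext fun s => ?_)
  rw [hfs]
  simp [funext_iff.1 hc]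

/-! ### Evaluation of the twisted crossed product -/

namespace TwistedCrossedProduct

variable {W X : Type*} [Group W] [TopologicalSpace X] [MulAction W X] {γ : TwistingCocycle W X}

/-- The element `b w` of the crossed product. -/
def single [DecidableEq W] (γ : TwistingCocycle W X) (w : W) (b : C₀(X, ℂ)) :
    TwistedCrossedProduct γ :=
  mk (Pi.single w b)

theorem coeff_single_same [DecidableEq W] (w : W) (b : C₀(X, ℂ)) :
    (single γ w b).coeff w = b :=
  Pi.single_eq_same (M := fun _ : W => C₀(X, ℂ)) w b

theorem coeff_single_of_ne [DecidableEq W] {w u : W} (h : u ≠ w) (b : C₀(X, ℂ)) :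
    (single γ w b).coeff u = 0 :=
  Pi.single_eq_of_ne (M := fun _ : W => C₀(X, ℂ)) h b

/-- The linear functional `f ↦ f_w(x)`. -/
def evalCoeff (γ : TwistingCocycle W X) (w : W) (x : X) : TwistedCrossedProduct γ →ₗ[ℂ] ℂ where
  toFun f := f.coeff w x
  map_add' _ _ := rfl
  map_smul' _ _ := rfl

@[simp]
theorem evalCoeff_apply (w : W) (x : X) (f : TwistedCrossedProduct γ) :
    evalCoeff γ w x f = f.coeff w x := rfl

variable [Fintype W] [ContinuousConstSMul W X]

theorem norm_coeff_apply_le (f : TwistedCrossedProduct γ) (w : W) (x : X) :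
    ‖f.coeff w x‖ ≤ ‖f‖ := by
  have h : regular f w 1 (w⁻¹ • x) = f.coeff w x := by
    simp [regular_apply, γ.one_right]
  rw [← h]
  exact (C0.norm_apply_le _ _).trans CStarMatrix.norm_entry_le_norm

theorem continuous_evalCoeff (w : W) (x : X) : Continuous (evalCoeff γ w x) :=
  AddMonoidHomClass.continuous_of_bound (evalCoeff γ w x) 1 fun f => by
    rw [one_mul]
    exact norm_coeff_apply_le f w x

variable [DecidableEq W]

theorem coeff_single_one_mul_apply (b : C₀(X, ℂ)) (f : TwistedCrossedProduct γ) (u : W) (x : X) :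
    (single γ 1 b * f).coeff u x = b x * f.coeff u x := by
  rw [coeff_mul, C0_sum_apply, Finset.sum_eq_single 1]
  · simp [coeff_single_same, γ.one_left]
  · intro v _ hv
    simp [coeff_single_of_ne hv]
  · simp

theorem coeff_mul_single_apply (f : TwistedCrossedProduct γ) (w : W) (b : C₀(X, ℂ)) (u : W)
    (x : X) : (f * single γ w b).coeff u x =
      (γ (u * w⁻¹) w x : ℂ) * (f.coeff (u * w⁻¹) x * b ((u * w⁻¹)⁻¹ • x)) := by
  rw [coeff_mul, C0_sum_apply, Finset.sum_eq_single (u * w⁻¹)]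
  · have e : (u * w⁻¹)⁻¹ * u = w := by group
    simp only [e, coeff_single_same, C0.unitaryMul_apply, ZeroAtInftyContinuousMap.coe_mul,
      Pi.mul_apply, C0.translate_apply]
  · intro v _ hv
    have hne : v⁻¹ * u ≠ w := fun h => hv (by rw [← h]; group)
    simp [coeff_single_of_ne hne]
  · simp

end TwistedCrossedProduct

namespace TwistedModuleAction

variable {W X : Type*} [Group W] [TopologicalSpace X] [MulAction W X]
  [ContinuousConstSMul W X] {γ : TwistingCocycle W X} {E : Type*}
  [NormedAddCommGroup E] [NormedSpace ℂ E] [SMul C₀(X, ℂ) E] [CStarModule C₀(X, ℂ) E]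
  (U : TwistedModuleAction γ E)

section Ideal

variable [Fintype W]

/-! ### Fullness of the right inner product -/

/-- The span of the `C₀(X) ⋊_γ W`-valued inner products. -/
def innerSpan : Submodule ℂ (TwistedCrossedProduct γ) :=
  Submodule.span ℂ {b | ∃ ξ η : E, b = U.crossedInner ξ η}

/-- The factor is absorbed into the second vector. Together with the left-handed version this makes
the span a two-sided ideal, which allows localisation by functions. -/
theorem mul_mem_innerSpan {f : TwistedCrossedProduct γ} (hf : f ∈ U.innerSpan)
    (b : TwistedCrossedProduct γ) : f * b ∈ U.innerSpan := by
  rw [innerSpan] at hf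
  induction hf using Submodule.span_induction with
  | mem f hf =>
    obtain ⟨ξ, η, rfl⟩ := hf
    exact Submodule.subset_span ⟨ξ, U.rightSMul η b, (U.crossedInner_rightSMul ξ η b).symm⟩
  | zero => rw [zero_mul]; exact Submodule.zero_mem _
  | add f g _ _ hf hg => rw [add_mul]; exact Submodule.add_mem _ hf hg
  | smul c f _ hf => rw [smul_mul_assoc]; exact Submodule.smul_mem _ _ hf

theorem innerSpan_mul_mem {f : TwistedCrossedProduct γ} (hf : f ∈ U.innerSpan)
    (b : TwistedCrossedProduct γ) : b * f ∈ U.innerSpan := by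
  rw [innerSpan] at hf
  induction hf using Submodule.span_induction with
  | mem f hf =>
    obtain ⟨ξ, η, rfl⟩ := hf
    refine Submodule.subset_span ⟨U.rightSMul ξ (star b), η, ?_⟩
    rw [U.crossedInner_rightSMul_left, star_star]
  | zero => rw [mul_zero]; exact Submodule.zero_mem _
  | add f g _ _ hf hg => rw [mul_add]; exact Submodule.add_mem _ hf hg
  | smul c f _ hf => rw [mul_smul_comm]; exact Submodule.smul_mem _ _ hf

end Ideal

/-! ### Matrix coefficients and irreducible representations -/

theorem inner_eval_localRep (x : X) (ξ η : E) (w : MulAction.stabilizer W x) :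
    inner ℂ (Fibre.eval x ξ) ((U.localRep x).toFun w (Fibre.eval x η)) =
      inner C₀(X, ℂ) ξ (U.U w η) x := by
  rw [show (U.localRep x).toFun w (Fibre.eval x η) = Fibre.eval x (U.U w η) from
    U.intertwiner_eval (w : W) w.2 η]
  exact UniformSpace.Completion.inner_coe _ _

variable [∀ x : X, Fintype (MulAction.stabilizer W x)]

/-- The matrix coefficients of `I_x` span the functions on `W_x`. -/
def MatrixCoeffsSpan (x : X) : Prop :=
  ∀ c : MulAction.stabilizer W x → ℂ,
    (∀ ξ η : E, ∑ w : MulAction.stabilizer W x, inner C₀(X, ℂ) ξ (U.U w η) x * c w = 0) → c = 0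

/-- A relation among the matrix coefficients at vectors from `E` is a relation among the operators
`I_{w,x}`, because these vectors are dense in the fibre. -/
theorem sum_smul_localRep_eq_zero {x : X} {c : MulAction.stabilizer W x → ℂ}
    (hc : ∀ ξ η : E, ∑ w : MulAction.stabilizer W x, inner C₀(X, ℂ) ξ (U.U w η) x * c w = 0)
    (a : Fibre E x) :
    ∑ w, c w • (U.localRep x).toFun w a = 0 := by
  induction a using UniformSpace.Completion.induction_on with
  | hp =>
    exact isClosed_eq (continuous_finsetSum _ fun w _ =>
      ((U.localRep x).toFun w).continuous.const_smul (c w)) continuous_const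
  | ih a =>
    obtain ⟨η, rfl⟩ := (PreFibre.of E x).surjective a
    refine ext_inner_left ℂ fun b => ?_
    induction b using UniformSpace.Completion.induction_on with
    | hp => exact isClosed_eq (by fun_prop) (by fun_prop)
    | ih b =>
      obtain ⟨ξ, rfl⟩ := (PreFibre.of E x).surjective b
      rw [inner_zero_right, inner_sum, ← hc ξ η]
      refine Finset.sum_congr rfl fun w _ => ?_
      rw [inner_smul_right, mul_comm, ← U.inner_eval_localRep]
      rfl

/-- If `π` did not occur, Schur's lemma would make every averaged rank-one operator zero. Each
coefficient of `π` would then be a relation among the matrix coefficients of `I_x`, hence zero. -/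
theorem occursIn_of_matrixCoeffsSpan {x : X} (h : U.MatrixCoeffsSpan x) {H : Type*}
    [NormedAddCommGroup H] [InnerProductSpace ℂ H]
    (π : UnitaryProjRep (MulAction.stabilizer W x) (fun v w => γ v w x) H)
    (hπ : π.IsIrreducible) : π.OccursIn (U.localRep x).contragredient := by
  by_contra hocc
  have hT : ∀ v h, UnitaryProjRep.averagedRankOne π (U.localRep x).contragredient v h = 0 := by
    intro v h
    by_contra hne
    refine hocc (hπ.occursIn_of_intertwiner _ _ (fun g k =>
      UnitaryProjRep.averagedRankOne_intertwines _ _ (fun g₁ g₂ => ?_) v h g k) hne)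
    simp
  obtain ⟨k, hk⟩ := @exists_ne H hπ.1 0
  -- The vector `π(1) k` is used on the left so that this coefficient at `w = 1` is visibly a
  -- nonzero norm squared.
  have h1 := h (fun w => inner ℂ (π.toFun 1 k) (π.toFun w k)) fun ξ η => by
    have h2 := UnitaryProjRep.inner_averagedRankOne π (U.localRep x).contragredient
      (ConjSpace.conj _ (Fibre.eval x ξ)) (ConjSpace.conj _ (Fibre.eval x η)) (π.toFun 1 k) k
    rw [hT, LinearMap.zero_apply, inner_zero_right] at h2
    rw [h2]
    refine Finset.sum_congr rfl fun w _ => ?_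
    rw [← U.inner_eval_localRep]
    rfl
  have h3 := congrFun h1 1
  rw [Pi.zero_apply, inner_self_eq_zero] at h3
  exact hk ((π.toFun 1).map_eq_zero_iff.1 h3)

/-- A relation `c` gives `∑ c_w I_w = 0`, hence its conjugate gives zero on the contragredient and
on every irreducible representation occurring there. As irreducibles separate the twisted group
algebra, `c = 0`. -/
theorem matrixCoeffsSpan_of_occursIn {x : X}
    (h : ∀ (H : Type v) [NormedAddCommGroup H] [InnerProductSpace ℂ H] [CompleteSpace H]
      (π : UnitaryProjRep (MulAction.stabilizer W x) (fun v w => γ v w x) H),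
      π.IsIrreducible → π.OccursIn (U.localRep x).contragredient) :
    U.MatrixCoeffsSpan x := by
  intro c hc
  by_contra hne
  have hne' : star c ≠ 0 := star_ne_zero.2 hne
  obtain ⟨H, _, _, _, π, hπ, h₀, hh₀⟩ := UnitaryProjRep.exists_irreducible_sum_ne_zero.{v}
    (fun v w : MulAction.stabilizer W x => γ v w x) (fun u v w => by
      have h1 := γ.cocycle u v w x
      rwa [show (u : W)⁻¹ • x = x from (u⁻¹).2] at h1)
    (fun w => γ.one_right w x) (star c) hne'
  obtain ⟨T, hT⟩ := h H π hπ
  refine hh₀ ((map_eq_zero_iff T T.injective).1 ?_)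
  obtain ⟨a, ha⟩ := (ConjSpace.conj (Fibre E x)).surjective (T h₀)
  have h1 : ∀ w, star c w • (U.localRep x).contragredient.toFun w (T h₀) =
      ConjSpace.conj _ (c w • (U.localRep x).toFun w a) := fun w => by
    rw [← ha]
    change star c w • ConjSpace.conj _ ((U.localRep x).toFun w a) = _
    rw [ConjSpace.smul_conj, Pi.star_apply, star_star]
  rw [map_sum]
  simp only [LinearIsometry.map_smul, hT, h1]
  rw [← map_sum, U.sum_smul_localRep_eq_zero hc, map_zero]

variable [Fintype W]

theorem exists_mem_innerSpan_coeff_stabilizer {x : X} (h : U.MatrixCoeffsSpan x)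
    (s : MulAction.stabilizer W x → ℂ) :
    ∃ f ∈ U.innerSpan, ∀ w : MulAction.stabilizer W x, f.coeff w x = s w := by
  let ev : TwistedCrossedProduct γ →ₗ[ℂ] (MulAction.stabilizer W x → ℂ) :=
    LinearMap.pi fun w => TwistedCrossedProduct.evalCoeff γ w x
  have htop : U.innerSpan.map ev = ⊤ :=
    Submodule.eq_top_of_forall_sum_mul_eq_zero _ fun c hc => h c fun ξ η =>
      hc (ev (U.crossedInner ξ η))
        (Submodule.mem_map_of_mem (Submodule.subset_span ⟨ξ, η, rfl⟩))
  obtain ⟨f, hf, hfs⟩ : s ∈ U.innerSpan.map ev := htop ▸ Submodule.mem_top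
  exact ⟨f, hf, fun w => congrFun hfs w⟩

/-! ### Density of the span of the inner products -/

variable [T2Space X] [LocallyCompactSpace X]

/-- A relation at `x` defines a continuous functional that vanishes on the span, so on the whole
crossed product; evaluating it at `b w` with `b(x) = 1` isolates each coefficient. -/
theorem matrixCoeffsSpan_of_dense
    (h : Dense (U.innerSpan : Set (TwistedCrossedProduct γ))) (x : X) :
    U.MatrixCoeffsSpan x := by
  classical
  intro c hc
  let φ : TwistedCrossedProduct γ →ₗ[ℂ] ℂ :=
    ∑ w : MulAction.stabilizer W x, c w • TwistedCrossedProduct.evalCoeff γ w x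
  have hφ : ∀ f, φ f = ∑ w : MulAction.stabilizer W x, f.coeff w x * c w := fun f => by
    simp [φ, mul_comm]
  have hcont : Continuous φ := by
    rw [show (φ : TwistedCrossedProduct γ → ℂ) = fun f => ∑ w : MulAction.stabilizer W x,
      TwistedCrossedProduct.evalCoeff γ w x f * c w from funext hφ]
    exact continuous_finsetSum _ fun w _ =>
      (TwistedCrossedProduct.continuous_evalCoeff _ _).mul continuous_const
  have hle : U.innerSpan ≤ LinearMap.ker φ := by
    refine Submodule.span_le.2 ?_
    rintro _ ⟨ξ, η, rfl⟩
    exact (hφ _).trans (hc ξ η)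
  have hzero : ∀ f, φ f = 0 := fun f =>
    congrFun (Continuous.ext_on h hcont continuous_const fun f hf => hle hf) f
  obtain ⟨b, hb, -⟩ := C0.exists_eq_one_eq_zero (Set.finite_empty) (Set.notMem_empty x)
  funext w
  have h1 := hzero (TwistedCrossedProduct.single γ w b)
  rw [hφ, Finset.sum_eq_single w, TwistedCrossedProduct.coeff_single_same, hb, one_mul] at h1
  · exact h1
  · intro v _ hv
    rw [TwistedCrossedProduct.coeff_single_of_ne (fun h => hv (Subtype.ext h))]
    simp
  · simp

/-- Begin with an element whose coefficients at `x` are `δ_1` on the stabiliser and uncontrolled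
elsewhere. Right multiplication by `b w` shifts them by `w`, and a bump `b` at `x` that vanishes on
the rest of the finite orbit removes the uncontrolled ones. -/
theorem exists_mem_innerSpan_coeff_eq_ite [DecidableEq W] {x : X} (h : U.MatrixCoeffsSpan x)
    (w : W) :
    ∃ f ∈ U.innerSpan, ∀ u, f.coeff u x = if u = w then 1 else 0 := by
  obtain ⟨g, hg, hgs⟩ := U.exists_mem_innerSpan_coeff_stabilizer h
    (fun w => if (w : W) = 1 then 1 else 0)
  obtain ⟨b, hbx, hb⟩ := C0.exists_eq_one_eq_zero (x := x) (s := MulAction.orbit W x \ {x})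
    ((Set.finite_range _).sdiff) (fun h => h.2 rfl)
  refine ⟨g * TwistedCrossedProduct.single γ w b, U.mul_mem_innerSpan hg _, fun u => ?_⟩
  rw [TwistedCrossedProduct.coeff_mul_single_apply]
  by_cases hs : (u * w⁻¹)⁻¹ • x = x
  · have hs' : u * w⁻¹ ∈ MulAction.stabilizer W x := by
      rw [← inv_mem_iff]
      exact hs
    have h1 : g.coeff (u * w⁻¹) x = if u * w⁻¹ = 1 then 1 else 0 := hgs ⟨_, hs'⟩
    rw [hs, hbx, h1]
    by_cases huw : u = w
    · simp [huw, γ.one_left]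
    · simp [huw, mul_inv_eq_one]
  · have huw : u ≠ w := fun huw => hs (by simp [huw])
    rw [hb _ ⟨⟨_, rfl⟩, hs⟩, mul_zero, mul_zero, if_neg huw]

theorem exists_mem_innerSpan_coeff_eq {x : X} (h : U.MatrixCoeffsSpan x) (s : W → ℂ) :
    ∃ f ∈ U.innerSpan, ∀ u, f.coeff u x = s u := by
  classical
  choose F hF hF' using U.exists_mem_innerSpan_coeff_eq_ite h
  refine ⟨∑ w, s w • F w, Submodule.sum_mem _ fun w _ => Submodule.smul_mem _ _ (hF w),
    fun u => ?_⟩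
  rw [← TwistedCrossedProduct.evalCoeff_apply, map_sum]
  simp [hF']

/-- At each point some element of the ideal has the same coefficients as `f`, so it is close to `f`
on a neighbourhood. A partition of unity, acting by left multiplication, glues finitely many of
these elements. -/
theorem dense_of_matrixCoeffsSpan (h : ∀ x, U.MatrixCoeffsSpan x) :
    Dense (U.innerSpan : Set (TwistedCrossedProduct γ)) := by
  classical
  intro f
  rw [Metric.mem_closure_iff]
  intro δ hδ
  obtain ⟨C, hC, hnorm⟩ := TwistedCrossedProduct.exists_norm_le_of_coeff_apply γ
  -- An entrywise error `ε` costs at most `C ε = δ / 2` in the C⋆-norm.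
  set ε : ℝ := δ / (2 * C) with hεdef
  have hε : 0 < ε := by positivity
  choose j hj hjx using fun x => U.exists_mem_innerSpan_coeff_eq (h x) fun w => f.coeff w x
  let V : X → Set X := fun x => {y | ∀ w, ‖f.coeff w y - (j x).coeff w y‖ < ε}
  have hV : ∀ x, IsOpen (V x) := fun x => by
    simp only [V, Set.ofPred_forall]
    exact isOpen_iInter_of_finite fun w => isOpen_lt (by fun_prop) continuous_const
  have hxV : ∀ x, x ∈ V x := fun x w => by
    rw [hjx, sub_self, norm_zero]
    exact hε
  -- Off this compact set every coefficient of `f` is already smaller than `ε`, so the partition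
  -- needs to sum to `1` only on it; elsewhere the missing weight falls on `0`.
  have hL : IsCompact (⋃ w : W, {x | ε ≤ ‖f.coeff w x‖}) :=
    isCompact_iUnion fun w => C0.isCompact_le_norm _ hε
  obtain ⟨t, ht⟩ := hL.elim_finite_subcover V hV fun x _ => Set.mem_iUnion.2 ⟨x, hxV x⟩
  obtain ⟨p, hpsub, hpcpt⟩ := PartitionOfUnity.exists_isSubordinate_of_locallyFinite_t2space hL
    (fun x : t => V x) (fun x => hV x) (locallyFinite_of_finite _)
    (fun y hy => by
      obtain ⟨x, hx, hxy⟩ := Set.mem_iUnion₂.1 (ht hy)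
      exact Set.mem_iUnion.2 ⟨⟨x, hx⟩, hxy⟩)
  refine ⟨∑ x : t, TwistedCrossedProduct.single γ 1 (C0.ofCompactSupport (p x) (hpcpt x)) * j x,
    Submodule.sum_mem _ fun x _ => U.innerSpan_mul_mem (hj x) _, ?_⟩
  rw [dist_eq_norm]
  refine lt_of_le_of_lt (hnorm _ ε hε.le fun w y => ?_) ?_
  · rw [← TwistedCrossedProduct.evalCoeff_apply, map_sub, map_sum]
    simp only [TwistedCrossedProduct.evalCoeff_apply,
      TwistedCrossedProduct.coeff_single_one_mul_apply, C0.ofCompactSupport_apply]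
    refine norm_sub_sum_mul_le _ _ (fun x => p x y) (fun x => p.nonneg x y) ?_ ?_ ?_
    · rw [← finsum_eq_sum_of_fintype]
      exact p.sum_le_one y
    · intro x hx
      exact (hpsub x (subset_tsupport _ hx) w).le
    · rw [← finsum_eq_sum_of_fintype]
      by_cases hy : ε ≤ ‖f.coeff w y‖
      · exact Or.inl (p.sum_eq_one (Set.mem_iUnion.2 ⟨w, hy⟩))
      · exact Or.inr (not_le.1 hy).le
  · rw [hεdef]
    field_simp
    norm_num

end TwistedModuleAction

end

/-! ### The criterion for Morita equivalence -/

theorem mainTheorem10 {W X E : Type*}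
    [Group W] [Fintype W]
    [TopologicalSpace X] [T2Space X] [LocallyCompactSpace X]
    [MulAction W X] [ContinuousConstSMul W X]
    (γ : TwistingCocycle W X)
    [NormedAddCommGroup E] [NormedSpace ℂ E] [CompleteSpace E]
    [SMul C₀(X, ℂ) E] [CStarModule C₀(X, ℂ) E]
    (U : TwistedModuleAction γ E) :
    IsMoritaEquivalence (A := U.fixedCompacts) (B := TwistedCrossedProduct γ)
        U.leftSMul U.rightSMul U.crossedInner ↔
      ∀ (x : X) (H : Type v) [NormedAddCommGroup H] [InnerProductSpace ℂ H] [CompleteSpace H]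
        (π : UnitaryProjRep (MulAction.stabilizer W x) (fun v w => γ v w x) H),
        π.IsIrreducible → π.OccursIn (U.localRep x).contragredient := by
  classical
  rw [U.isMoritaEquivalence_iff_dense]
  exact ⟨fun h x H _ _ _ π hπ =>
      U.occursIn_of_matrixCoeffsSpan (U.matrixCoeffsSpan_of_dense h x) π hπ,
    fun h => U.dense_of_matrixCoeffsSpan fun x => U.matrixCoeffsSpan_of_occursIn (h x)⟩
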